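/- Let $\mathbb{H}^3$ be three-dimensional hyperbolic space with its distance function $d$. Let $M$ be a closed connected surface (a compact connected smooth two-dimensional manifold without boundary), smoothly immersed in $\mathbb{H}^3$ by $F : M \to \mathbb{H}^3$ (in particular, $M$ may be an embedded surface). Let $d\sigma$ be the area element of the metric induced on $M$, let $A(M)=\int_M d\sigma$ be its area, let $H=\frac{1}{2}(k_1+k_2)$ be its mean curvature, where $k_1,k_2$ are the principal curvatures with respect to a local unit normal, and let $$W(M)=\int_M H^2\,d\sigma .$$ Then $A(M)$ and $W(M)$ are finite, the extrinsic diameter $\mathrm{diam}(M)=\max_{p,q\in M} d(F(p),F(q))$ exists, and $$\mathrm{diam}(M)\le \frac{7}{2\pi}\,A(M)^{1/2}\,W(M)^{1/2}.$$ -/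

import Mathlib

open scoped Manifold ContDiff
open MeasureTheory

/-- The vector space underlying Minkowski space `ℝ^{1,3}`; coordinate `0` is the time coordinate. -/
abbrev Mink : Type := Fin 4 → ℝ

/-- The coordinate plane `ℝ²` on which surfaces are modelled. -/
abbrev Plane : Type := EuclideanSpace ℝ (Fin 2)

/-- The Lorentzian inner product `-x₀y₀ + x₁y₁ + x₂y₂ + x₃y₃`. -/
def lorentz (x y : Mink) : ℝ := -(x 0 * y 0) + x 1 * y 1 + x 2 * y 2 + x 3 * y 3

/-- Hyperbolic space `ℍ³` in the hyperboloid model: the upper sheet of `⟨x, x⟩ = -1`, with the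
Riemannian metric induced by the Lorentzian inner product. -/
def hyperbolicSpace : Set Mink := {x | lorentz x x = -1 ∧ 0 < x 0}

/-- The hyperbolic distance: `cosh d(x, y) = -⟨x, y⟩`. -/
noncomputable def hypDist (x y : Mink) : ℝ := Real.arcosh (-lorentz x y)

/-- `i`-th partial derivative of a map `φ : ℝ² → ℝ^{1,3}`. -/
noncomputable def pd (φ : Plane → Mink) (i : Fin 2) (u : Plane) : Mink :=
  fderiv ℝ φ u (EuclideanSpace.single i 1)

/-- First fundamental form `g_{ij} = ⟨∂_i φ, ∂_j φ⟩` of a local parametrization `φ`. -/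
noncomputable def firstForm (φ : Plane → Mink) (u : Plane) : Matrix (Fin 2) (Fin 2) ℝ :=
  Matrix.of fun i j => lorentz (pd φ i u) (pd φ j u)

/-- The Lorentzian cross product of three vectors, characterised by
`⟨cross3 a b c, w⟩ = det (w, a, b, c)` for all `w`. -/
noncomputable def cross3 (a b c : Mink) : Mink := fun k =>
  (if k = 0 then -1 else 1) * Matrix.det (Matrix.of ![Pi.single k 1, a, b, c])

/-- Unit normal of a local parametrization `φ` with values in `ℍ³`. It is Lorentz-orthogonal to
`φ u`, hence tangent to `ℍ³` at `φ u`, and orthogonal to `∂₁ φ` and `∂₂ φ`. -/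
noncomputable def unitNormal (φ : Plane → Mink) (u : Plane) : Mink :=
  let n := cross3 (φ u) (pd φ 0 u) (pd φ 1 u)
  (Real.sqrt (lorentz n n))⁻¹ • n

/-- Second fundamental form `h_{ij} = ⟨∇_{∂_i φ} ∂_j φ, ν⟩` of a local parametrization in `ℍ³`.
The Levi-Civita connection of `ℍ³` is the tangential part of the flat connection of `ℝ^{1,3}` and
`ν` is tangent to `ℍ³`, so this is `⟨∂_i ∂_j φ, ν⟩`. -/
noncomputable def secondForm (φ : Plane → Mink) (u : Plane) : Matrix (Fin 2) (Fin 2) ℝ :=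
  Matrix.of fun i j => lorentz (pd (pd φ j) i u) (unitNormal φ u)

/-- The matrix `g⁻¹ h` of the shape operator; its eigenvalues are the principal curvatures
`k₁`, `k₂`. -/
noncomputable def shapeOperator (φ : Plane → Mink) (u : Plane) : Matrix (Fin 2) (Fin 2) ℝ :=
  (firstForm φ u)⁻¹ * secondForm φ u

section Surface

variable {M : Type*} [TopologicalSpace M] [ChartedSpace Plane M]

/-- `F` is a smooth immersion of the surface `M` into `ℍ³`. -/
structure IsHypImmersion (F : M → Mink) : Prop where
  smooth : ContMDiff (𝓡 2) 𝓘(ℝ, Mink) ∞ F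
  mem : ∀ x, F x ∈ hyperbolicSpace
  injective_mfderiv : ∀ x, Function.Injective (mfderiv (𝓡 2) 𝓘(ℝ, Mink) F x)

/-- Mean curvature `H = (k₁ + k₂) / 2` at `x`, computed in the preferred chart at `x`. The
sign depends on the unit normal, hence on the chart; `H ^ 2` does not. -/
noncomputable def meanCurvature (F : M → Mink) (x : M) : ℝ :=
  (shapeOperator (F ∘ (chartAt Plane x).symm) (chartAt Plane x x)).trace / 2

/-- The area measure of the domain of a chart `e`: the measure `√(det g) du` on `e.target`,
transported to `M`. -/
noncomputable def chartArea [MeasurableSpace M] (F : M → Mink) (e : OpenPartialHomeomorph M Plane) :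
    Measure M :=
  (((volume : Measure Plane).restrict e.target).withDensity fun u =>
    ENNReal.ofReal (Real.sqrt (firstForm (F ∘ e.symm) u).det)).map e.symm

/-- The area measure `dσ` induced on `M` by an immersion `F`: the least measure that dominates the
area measure of each chart domain. Since these agree on overlaps, it restricts to
`chartArea F e` on the domain of each chart `e`. -/
noncomputable def areaMeasure [MeasurableSpace M] (F : M → Mink) : Measure M :=
  ⨆ e ∈ atlas Plane M, chartArea F e

/-- The area `A(M)`. -/
noncomputable def surfaceArea [MeasurableSpace M] (F : M → Mink) : ℝ :=
  (areaMeasure F).real Set.univ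

/-- The Willmore energy `W(M) = ∫_M H² dσ`. -/
noncomputable def willmoreEnergy [MeasurableSpace M] (F : M → Mink) : ℝ :=
  ∫ x, meanCurvature F x ^ 2 ∂(areaMeasure F)

end Surface

/-- The extrinsic distances between pairs of points of the surface. -/
def extrinsicDistances {M : Type*} (F : M → Mink) : Set ℝ :=
  Set.range fun p : M × M => hypDist (F p.1) (F p.2)

/-- The extrinsic diameter `max_{p, q} d(p, q)`. -/
noncomputable def extrinsicDiam {M : Type*} (F : M → Mink) : ℝ := sSup (extrinsicDistances F)

/-!
Let `t = cosh r`, where `r` is the distance in `ℍ³` from a point `F x₀` of the surface. The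
Laplacian of `t` on the surface is `2 t - 2 H ⟨F x₀, ν⟩`. Integrating the divergence of `ψ ∇t` with
the weight `ψ = (1 - sinh² r / sinh² R)₊² / (sinh² r + c)` and absorbing the mean curvature term
into a square bounds the integral of the kernel `c (1 - sinh² r / sinh² R)₊² / (sinh² r + c)²` by
that of `2 / R² + H² / 4` over the ball of radius `R` around `F x₀`. As `c → 0`, a blow-up at `x₀`
shows that the kernel has mass at least `∫_{ℝ²} (1 + |v|²)⁻² = π` in the limit, so
`π ≤ ∫_{B_R(x₀)} (2 / R² + H² / 4)`.

Let `D` be the diameter, attained at `p` and `q`. Since `M` is connected, it contains points at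
distance `0, 2R, 4R, …` from `p`, more than `D / (2R)` in number, and the balls of radius `R` around
them are disjoint. Summing up gives `π D / (2R) ≤ 2 A / R² + W / 4` for every `R > 0`, and the
discriminant of this quadratic inequality in `R` gives `π² D² ≤ 8 A W`.
-/

/-! ### Lorentzian linear algebra -/

section Lorentz

variable {x y z u v w : Mink}

theorem lorentz_comm (x y : Mink) : lorentz x y = lorentz y x := by
  simp only [lorentz]; ring

theorem lorentz_add_left (x y z : Mink) : lorentz (x + y) z = lorentz x z + lorentz y z := by
  simp only [lorentz, Pi.add_apply]; ring

theorem lorentz_add_right (x y z : Mink) : lorentz x (y + z) = lorentz x y + lorentz x z := by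
  simp only [lorentz, Pi.add_apply]; ring

theorem lorentz_smul_left (c : ℝ) (x y : Mink) : lorentz (c • x) y = c * lorentz x y := by
  simp only [lorentz, Pi.smul_apply, smul_eq_mul]; ring

theorem lorentz_smul_right (c : ℝ) (x y : Mink) : lorentz x (c • y) = c * lorentz x y := by
  simp only [lorentz, Pi.smul_apply, smul_eq_mul]; ring

/-- The Lorentzian inner product as a continuous bilinear map. -/
noncomputable def lorentzCLM : Mink →L[ℝ] Mink →L[ℝ] ℝ :=
  (LinearMap.mk₂ ℝ lorentz lorentz_add_left lorentz_smul_left lorentz_add_right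
    lorentz_smul_right).toContinuousBilinearMap

theorem lorentzCLM_apply (x y : Mink) : lorentzCLM x y = lorentz x y := rfl

theorem lorentz_neg_left (x y : Mink) : lorentz (-x) y = -lorentz x y := by
  simp only [← lorentzCLM_apply, map_neg, neg_apply]

theorem lorentz_sub_left (x y z : Mink) : lorentz (x - y) z = lorentz x z - lorentz y z := by
  simp only [← lorentzCLM_apply, map_sub, sub_apply]

theorem lorentz_sub_right (x y z : Mink) : lorentz x (y - z) = lorentz x y - lorentz x z := by
  simp only [← lorentzCLM_apply, map_sub]

theorem lorentz_sum_left {ι : Type*} (s : Finset ι) (f : ι → Mink) (y : Mink) :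
    lorentz (∑ i ∈ s, f i) y = ∑ i ∈ s, lorentz (f i) y := by
  simp only [← lorentzCLM_apply, map_sum, sum_apply]

theorem lorentz_sum_right {ι : Type*} (s : Finset ι) (x : Mink) (f : ι → Mink) :
    lorentz x (∑ i ∈ s, f i) = ∑ i ∈ s, lorentz x (f i) := by
  simp only [← lorentzCLM_apply, map_sum]

theorem lorentz_ext (h : ∀ w, lorentz x w = lorentz y w) : x = y := by
  ext k
  have := h (Pi.single k 1)
  fin_cases k <;> simpa [lorentz] using this

theorem continuous_lorentz : Continuous fun p : Mink × Mink => lorentz p.1 p.2 := by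
  unfold lorentz; fun_prop

section Calculus

variable {E : Type*} [NormedAddCommGroup E] [NormedSpace ℝ E] {a b : E → Mink}

theorem fderiv_lorentz_apply {p : E} (ha : DifferentiableAt ℝ a p)
    (hb : DifferentiableAt ℝ b p) (v : E) :
    fderiv ℝ (fun p => lorentz (a p) (b p)) p v =
      lorentz (fderiv ℝ a p v) (b p) + lorentz (a p) (fderiv ℝ b p v) := by
  have h := lorentzCLM.hasFDerivAt_of_bilinear ha.hasFDerivAt hb.hasFDerivAt
  simp only [lorentzCLM_apply] at h
  rw [h.fderiv]
  simp [lorentzCLM_apply, add_comm]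

theorem contDiffOn_lorentz {U : Set E} {n : WithTop ℕ∞} (ha : ContDiffOn ℝ n a U)
    (hb : ContDiffOn ℝ n b U) : ContDiffOn ℝ n (fun p => lorentz (a p) (b p)) U :=
  (lorentzCLM.contDiff.comp_contDiffOn ha).clm_apply hb

end Calculus

theorem sq_add_sq_add_sq_le_of_lorentz_eq_zero (hx : x ∈ hyperbolicSpace) (hv : lorentz x v = 0) :
    v 1 ^ 2 + v 2 ^ 2 + v 3 ^ 2 ≤ x 0 ^ 2 * lorentz v v := by
  have hxx := hx.1
  simp only [lorentz] at hv hxx ⊢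
  have htime : x 0 ^ 2 = 1 + x 1 ^ 2 + x 2 ^ 2 + x 3 ^ 2 := by linear_combination -hxx
  have hlagrange : x 0 ^ 2 * (-(v 0 * v 0) + v 1 * v 1 + v 2 * v 2 + v 3 * v 3) =
      v 1 ^ 2 + v 2 ^ 2 + v 3 ^ 2 + (x 1 * v 2 - x 2 * v 1) ^ 2 + (x 1 * v 3 - x 3 * v 1) ^ 2 +
        (x 2 * v 3 - x 3 * v 2) ^ 2 := by
    linear_combination (v 1 ^ 2 + v 2 ^ 2 + v 3 ^ 2) * htime +
      (x 0 * v 0 + x 1 * v 1 + x 2 * v 2 + x 3 * v 3) * hv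
  rw [hlagrange]
  linarith [sq_nonneg (x 1 * v 2 - x 2 * v 1), sq_nonneg (x 1 * v 3 - x 3 * v 1),
    sq_nonneg (x 2 * v 3 - x 3 * v 2)]

theorem lorentz_self_nonneg (hx : x ∈ hyperbolicSpace) (hv : lorentz x v = 0) :
    0 ≤ lorentz v v := by
  refine nonneg_of_mul_nonneg_right ?_ (pow_pos hx.2 2)
  exact le_trans (by positivity) (sq_add_sq_add_sq_le_of_lorentz_eq_zero hx hv)

theorem lorentz_self_pos (hx : x ∈ hyperbolicSpace) (hv : lorentz x v = 0) (hne : v ≠ 0) :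
    0 < lorentz v v := by
  refine lt_of_le_of_ne (lorentz_self_nonneg hx hv) fun h0 => hne ?_
  have h := sq_add_sq_add_sq_le_of_lorentz_eq_zero hx hv
  rw [← h0, mul_zero] at h
  have h1 : v 1 = 0 := by nlinarith [sq_nonneg (v 1), sq_nonneg (v 2), sq_nonneg (v 3)]
  have h2 : v 2 = 0 := by nlinarith [sq_nonneg (v 1), sq_nonneg (v 2), sq_nonneg (v 3)]
  have h3 : v 3 = 0 := by nlinarith [sq_nonneg (v 1), sq_nonneg (v 2), sq_nonneg (v 3)]
  have htime : x 0 * v 0 = 0 := by simpa [lorentz, h1, h2, h3] using hv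
  have h4 : v 0 = 0 := (mul_eq_zero.1 htime).resolve_left hx.2.ne'
  ext i
  fin_cases i <;> assumption

theorem one_le_neg_lorentz (hx : x ∈ hyperbolicSpace) (hy : y ∈ hyperbolicSpace) :
    1 ≤ -lorentz x y := by
  obtain ⟨hxx, hx0⟩ := hx
  obtain ⟨hyy, hy0⟩ := hy
  simp only [lorentz] at hxx hyy ⊢
  have hcs : (1 + (x 1 * y 1 + x 2 * y 2 + x 3 * y 3)) ^ 2 ≤ (x 0 * y 0) ^ 2 := by
    rw [mul_pow, show x 0 ^ 2 = 1 + (x 1 ^ 2 + x 2 ^ 2 + x 3 ^ 2) by linarith,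
      show y 0 ^ 2 = 1 + (y 1 ^ 2 + y 2 ^ 2 + y 3 ^ 2) by linarith]
    nlinarith [sq_nonneg (x 1 * y 2 - x 2 * y 1), sq_nonneg (x 1 * y 3 - x 3 * y 1),
      sq_nonneg (x 2 * y 3 - x 3 * y 2), sq_nonneg (x 1 - y 1), sq_nonneg (x 2 - y 2),
      sq_nonneg (x 3 - y 3)]
  linarith [(abs_le_of_sq_le_sq' hcs (mul_pos hx0 hy0).le).2]

theorem lorentz_sq_le (hx : x ∈ hyperbolicSpace) (hu : lorentz x u = 0) (hv : lorentz x v = 0) :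
    lorentz u v ^ 2 ≤ lorentz u u * lorentz v v := by
  have h : ∀ t : ℝ, 0 ≤ lorentz v v * (t * t) + 2 * lorentz u v * t + lorentz u u := by
    intro t
    have htan : lorentz x (u + t • v) = 0 := by
      rw [lorentz_add_right, lorentz_smul_right, hu, hv, mul_zero, add_zero]
    have hnn := lorentz_self_nonneg hx htan
    simp only [lorentz_add_right, lorentz_add_left, lorentz_smul_left, lorentz_smul_right,
      lorentz_comm v u] at hnn
    linarith
  have hdiscr := discrim_le_zero h
  rw [discrim] at hdiscr
  linarith

end Lorentz

section HypDist

variable {x y z : Mink}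

theorem hypDist_comm (x y : Mink) : hypDist x y = hypDist y x := by
  rw [hypDist, hypDist, lorentz_comm]

theorem hypDist_nonneg (hx : x ∈ hyperbolicSpace) (hy : y ∈ hyperbolicSpace) :
    0 ≤ hypDist x y :=
  Real.arcosh_nonneg (one_le_neg_lorentz hx hy)

theorem cosh_hypDist (hx : x ∈ hyperbolicSpace) (hy : y ∈ hyperbolicSpace) :
    Real.cosh (hypDist x y) = -lorentz x y :=
  Real.cosh_arcosh (one_le_neg_lorentz hx hy)

theorem sinh_hypDist (hx : x ∈ hyperbolicSpace) (hy : y ∈ hyperbolicSpace) :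
    Real.sinh (hypDist x y) = √(lorentz x y ^ 2 - 1) := by
  rw [hypDist, Real.sinh_arcosh (one_le_neg_lorentz hx hy), neg_sq]

theorem hypDist_self (hx : x ∈ hyperbolicSpace) : hypDist x x = 0 := by
  simp [hypDist, hx.1]

theorem lorentz_add_mul_sq_le (hx : x ∈ hyperbolicSpace) (hy : y ∈ hyperbolicSpace)
    (hz : z ∈ hyperbolicSpace) :
    (lorentz x z + lorentz x y * lorentz y z) ^ 2 ≤
      (lorentz x y ^ 2 - 1) * (lorentz y z ^ 2 - 1) := by
  -- Cauchy–Schwarz for the components of `x` and `z` tangent to `ℍ³` at `y`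
  have hu : lorentz y (x + lorentz x y • y) = 0 := by
    rw [lorentz_add_right, lorentz_smul_right, hy.1, lorentz_comm y x]; ring
  have hv : lorentz y (z + lorentz y z • y) = 0 := by
    rw [lorentz_add_right, lorentz_smul_right, hy.1]; ring
  have hcs := lorentz_sq_le hy hu hv
  simp only [lorentz_add_right, lorentz_add_left, lorentz_smul_left, lorentz_smul_right,
    lorentz_comm y x, lorentz_comm z y, hx.1, hy.1, hz.1] at hcs
  linarith

theorem hypDist_triangle (hx : x ∈ hyperbolicSpace) (hy : y ∈ hyperbolicSpace)
    (hz : z ∈ hyperbolicSpace) : hypDist x z ≤ hypDist x y + hypDist y z := by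
  rw [← abs_of_nonneg (hypDist_nonneg hx hz),
    ← abs_of_nonneg (add_nonneg (hypDist_nonneg hx hy) (hypDist_nonneg hy hz)),
    ← Real.cosh_le_cosh, Real.cosh_add, cosh_hypDist hx hz, cosh_hypDist hx hy,
    cosh_hypDist hy hz, sinh_hypDist hx hy, sinh_hypDist hy hz,
    ← Real.sqrt_mul (by nlinarith [one_le_neg_lorentz hx hy])]
  linarith [neg_abs_le (lorentz x z + lorentz x y * lorentz y z),
    Real.abs_le_sqrt (lorentz_add_mul_sq_le hx hy hz)]

end HypDist

section Cross

variable {a b c : Mink}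

theorem lorentz_cross3 (w a b c : Mink) :
    lorentz w (cross3 a b c) = Matrix.det (Matrix.of ![w, a, b, c]) := by
  simp [lorentz, cross3, Matrix.det_succ_row_zero, Fin.sum_univ_succ, Fin.succAbove,
    Pi.single_apply]
  ring

theorem lorentz_left_cross3 (a b c : Mink) : lorentz a (cross3 a b c) = 0 := by
  rw [lorentz_cross3]; exact Matrix.det_zero_of_row_eq (i := 0) (j := 1) (by decide) rfl

theorem lorentz_mid_cross3 (a b c : Mink) : lorentz b (cross3 a b c) = 0 := by
  rw [lorentz_cross3]; exact Matrix.det_zero_of_row_eq (i := 0) (j := 2) (by decide) rfl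

theorem lorentz_right_cross3 (a b c : Mink) : lorentz c (cross3 a b c) = 0 := by
  rw [lorentz_cross3]; exact Matrix.det_zero_of_row_eq (i := 0) (j := 3) (by decide) rfl

theorem of_lorentz_eq_mul (p q : Fin 4 → Mink) :
    Matrix.of (fun i j => lorentz (p i) (q j)) =
      Matrix.of p * Matrix.diagonal ![-1, 1, 1, 1] * (Matrix.of q).transpose := by
  ext i j
  rw [Matrix.mul_apply, Fin.sum_univ_four]
  simp only [Matrix.mul_diagonal]
  simp [lorentz]

theorem lorentz_cross3_mul (w z a b c : Mink) :
    lorentz w (cross3 a b c) * lorentz z (cross3 a b c) =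
      -Matrix.det (Matrix.of fun i j => lorentz (![w, a, b, c] i) (![z, a, b, c] j)) := by
  rw [of_lorentz_eq_mul, Matrix.det_mul, Matrix.det_mul, Matrix.det_transpose,
    Matrix.det_diagonal, lorentz_cross3, lorentz_cross3, Fin.prod_univ_four]
  simp

theorem lorentz_decomposition (ha : lorentz a a = -1) (hab : lorentz a b = 0)
    (hac : lorentz a c = 0) (w z : Mink) :
    (lorentz b b * lorentz c c - lorentz b c ^ 2) * lorentz w z =
      -(lorentz b b * lorentz c c - lorentz b c ^ 2) * (lorentz w a * lorentz z a) +
      (lorentz c c * (lorentz w b * lorentz z b) - lorentz b c * (lorentz w b * lorentz z c)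
        - lorentz b c * (lorentz w c * lorentz z b) + lorentz b b * (lorentz w c * lorentz z c)) +
      lorentz w (cross3 a b c) * lorentz z (cross3 a b c) := by
  rw [lorentz_cross3_mul]
  simp [Matrix.det_succ_row_zero, Fin.sum_univ_succ, Fin.succAbove, lorentz_comm b a,
    lorentz_comm c a, lorentz_comm c b, hab, hac, ha, lorentz_comm a z, lorentz_comm b z,
    lorentz_comm c z]
  ring

theorem eq_of_lorentz_eq {x y : Mink} (ha : lorentz a a = -1) (hab : lorentz a b = 0)
    (hac : lorentz a c = 0) (hD : lorentz b b * lorentz c c - lorentz b c ^ 2 ≠ 0)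
    (hxa : lorentz x a = lorentz y a) (hxb : lorentz x b = lorentz y b)
    (hxc : lorentz x c = lorentz y c)
    (hx : lorentz x (cross3 a b c) = lorentz y (cross3 a b c)) : x = y := by
  refine lorentz_ext fun w => mul_left_cancel₀ hD ?_
  rw [lorentz_decomposition ha hab hac, lorentz_decomposition ha hab hac, hxa, hxb, hxc, hx]

theorem lorentz_cross3_self (ha : lorentz a a = -1) (hab : lorentz a b = 0)
    (hac : lorentz a c = 0) :
    lorentz (cross3 a b c) (cross3 a b c) = lorentz b b * lorentz c c - lorentz b c ^ 2 := by
  have hgram : lorentz (cross3 a b c) (cross3 a b c) =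
      -Matrix.det !![lorentz a a, lorentz a b, lorentz a c;
        lorentz b a, lorentz b b, lorentz b c; lorentz c a, lorentz c b, lorentz c c] := by
    simp [lorentz, cross3, Matrix.det_succ_row_zero, Fin.sum_univ_succ, Fin.succAbove,
      Pi.single_apply]
    ring
  rw [hgram, Matrix.det_fin_three]
  simp [lorentz_comm b a, lorentz_comm c a, lorentz_comm c b, ha, hab, hac]
  ring

end Cross

/-! ### Parametrized surfaces in hyperbolic space -/

open scoped Matrix

/-- The partial derivatives of a real function on the coordinate plane. -/
noncomputable def partials (f : Plane → ℝ) (u : Plane) : Fin 2 → ℝ :=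
  fun i => fderiv ℝ f u (EuclideanSpace.single i 1)

section Partials

variable {u : Plane}

theorem plane_eq_sum (v : Plane) : v = ∑ i, v i • EuclideanSpace.single i (1 : ℝ) := by
  simpa using ((EuclideanSpace.basisFun (Fin 2) ℝ).sum_repr v).symm

theorem fderiv_apply_eq_sum_pd (φ : Plane → Mink) (u v : Plane) :
    fderiv ℝ φ u v = ∑ i, v i • pd φ i u := by
  conv_lhs => rw [plane_eq_sum v]
  simp only [map_sum, map_smul, pd]

theorem partials_congr {a b : Plane → ℝ} (h : a =ᶠ[nhds u] b) : partials a u = partials b u := by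
  ext i
  rw [partials, partials, h.fderiv_eq]

theorem partials_mul {a b : Plane → ℝ} (ha : DifferentiableAt ℝ a u)
    (hb : DifferentiableAt ℝ b u) :
    partials (fun u => a u * b u) u = a u • partials b u + b u • partials a u := by
  ext i
  simp [partials, fderiv_fun_mul ha hb]

theorem partials_sub {a b : Plane → ℝ} (ha : DifferentiableAt ℝ a u)
    (hb : DifferentiableAt ℝ b u) :
    partials (fun u => a u - b u) u = partials a u - partials b u := by
  ext i
  simp [partials, fderiv_fun_sub ha hb]

theorem partials_comp {k : ℝ → ℝ} {f : Plane → ℝ} (hk : DifferentiableAt ℝ k (f u))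
    (hf : DifferentiableAt ℝ f u) :
    partials (fun u => k (f u)) u = deriv k (f u) • partials f u := by
  ext i
  have hd : HasFDerivAt (fun u => k (f u)) _ u :=
    hk.hasDerivAt.comp_hasFDerivAt u hf.hasFDerivAt
  simp [partials, hd.fderiv]

theorem partials_lorentz {a b : Plane → Mink} (ha : DifferentiableAt ℝ a u)
    (hb : DifferentiableAt ℝ b u) (i : Fin 2) :
    partials (fun u => lorentz (a u) (b u)) u i =
      lorentz (pd a i u) (b u) + lorentz (a u) (pd b i u) :=
  fderiv_lorentz_apply ha hb _

theorem partials_lorentz_const (q : Mink) {b : Plane → Mink} (hb : DifferentiableAt ℝ b u) :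
    partials (fun u => lorentz q (b u)) u = fun i => lorentz q (pd b i u) := by
  ext i
  rw [partials_lorentz (differentiableAt_const q) hb i]
  simp [pd, lorentz]

theorem pd_smul {c : Plane → ℝ} {a : Plane → Mink} (hc : DifferentiableAt ℝ c u)
    (ha : DifferentiableAt ℝ a u) (i : Fin 2) :
    pd (fun u => c u • a u) i u = c u • pd a i u + partials c u i • a u := by
  simp [pd, partials, fderiv_fun_smul hc ha]

theorem pd_sum {ι : Type*} {s : Finset ι} {a : ι → Plane → Mink}
    (ha : ∀ j ∈ s, DifferentiableAt ℝ (a j) u) (i : Fin 2) :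
    pd (fun u => ∑ j ∈ s, a j u) i u = ∑ j ∈ s, pd (a j) i u := by
  simp [pd, fderiv_fun_sum ha]

end Partials

section FirstForm

variable (φ : Plane → Mink) (u : Plane)

theorem firstForm_comm (i j : Fin 2) : firstForm φ u i j = firstForm φ u j i :=
  lorentz_comm _ _

theorem firstForm_det : (firstForm φ u).det =
    lorentz (pd φ 0 u) (pd φ 0 u) * lorentz (pd φ 1 u) (pd φ 1 u)
      - lorentz (pd φ 0 u) (pd φ 1 u) ^ 2 := by
  rw [Matrix.det_fin_two, firstForm_comm φ u 1 0, sq]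
  rfl

theorem inv_firstForm : (firstForm φ u)⁻¹ = (firstForm φ u).det⁻¹ •
    !![lorentz (pd φ 1 u) (pd φ 1 u), -lorentz (pd φ 0 u) (pd φ 1 u);
      -lorentz (pd φ 0 u) (pd φ 1 u), lorentz (pd φ 0 u) (pd φ 0 u)] := by
  rw [Matrix.inv_def, Ring.inverse_eq_inv', Matrix.adjugate_fin_two, firstForm_comm φ u 1 0]
  rfl

theorem lorentz_fderiv_fderiv (v w : Plane) :
    lorentz (fderiv ℝ φ u v) (fderiv ℝ φ u w) = v ⬝ᵥ firstForm φ u *ᵥ w := by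
  simp only [fderiv_apply_eq_sum_pd, lorentz_sum_left, lorentz_sum_right, lorentz_smul_left,
    lorentz_smul_right, dotProduct, Matrix.mulVec, Finset.mul_sum, firstForm, Matrix.of_apply]
  rw [Finset.sum_comm]
  simp only [mul_assoc, mul_comm, mul_left_comm]

end FirstForm

/-- The mean curvature of a parametrized surface. -/
noncomputable def patchMeanCurvature (φ : Plane → Mink) (u : Plane) : ℝ :=
  (shapeOperator φ u).trace / 2

/-- The mean curvature vector `H ν` of a parametrized surface, which, unlike `H` and `ν`, does not
depend on the orientation of the parametrization. -/
noncomputable def patchMeanCurvatureVector (φ : Plane → Mink) (u : Plane) : Mink :=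
  patchMeanCurvature φ u • unitNormal φ u

/-- The Riemannian inner product `g^{ij} a_i b_j` of two covectors. -/
noncomputable def cometric (φ : Plane → Mink) (u : Plane) (a b : Fin 2 → ℝ) : ℝ :=
  a ⬝ᵥ (firstForm φ u)⁻¹ *ᵥ b

/-- The conormal density `√(det g) g^{ij} ∂_j φ`: the gradient of `f = ⟨q, φ⟩` has the coordinate
components `⟨q, conormal φ i⟩ / √(det g)`. -/
noncomputable def conormal (φ : Plane → Mink) (i : Fin 2) (u : Plane) : Mink :=
  ∑ j, (√(firstForm φ u).det * (firstForm φ u)⁻¹ i j) • pd φ j u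

theorem lorentz_conormal (φ : Plane → Mink) (i : Fin 2) (u : Plane) (w : Mink) :
    lorentz w (conormal φ i u) = √(firstForm φ u).det *
      ((firstForm φ u)⁻¹ *ᵥ fun j => lorentz w (pd φ j u)) i := by
  simp only [conormal, lorentz_sum_right, lorentz_smul_right, Matrix.mulVec, dotProduct,
    Finset.mul_sum, mul_assoc]

theorem sum_mul_lorentz_conormal (φ : Plane → Mink) (u : Plane) (a : Fin 2 → ℝ) (w : Mink) :
    ∑ i, a i * lorentz w (conormal φ i u) =
      √(firstForm φ u).det * cometric φ u a fun j => lorentz w (pd φ j u) := by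
  simp only [lorentz_conormal, cometric, dotProduct, Finset.mul_sum, mul_left_comm]

/-- `φ` restricts to a smooth immersion of the open set `U` into `ℍ³`. -/
structure HypPatch (φ : Plane → Mink) (U : Set Plane) : Prop where
  isOpen : IsOpen U
  contDiffOn : ContDiffOn ℝ ∞ φ U
  mem : ∀ u ∈ U, φ u ∈ hyperbolicSpace
  injective_fderiv : ∀ u ∈ U, Function.Injective (fderiv ℝ φ u)

namespace HypPatch

variable {φ : Plane → Mink} {U : Set Plane} {u : Plane}

theorem differentiableAt_of_contDiffOn (h : HypPatch φ U) {E : Type*} [NormedAddCommGroup E]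
    [NormedSpace ℝ E] {f : Plane → E} {n : WithTop ℕ∞} (hf : ContDiffOn ℝ n f U) (hn : n ≠ 0)
    (hu : u ∈ U) : DifferentiableAt ℝ f u :=
  (hf.contDiffAt (h.isOpen.mem_nhds hu)).differentiableAt hn

theorem contDiffOn_pd (h : HypPatch φ U) {ψ : Plane → Mink} (hψ : ContDiffOn ℝ ∞ ψ U)
    (i : Fin 2) : ContDiffOn ℝ ∞ (pd ψ i) U :=
  (hψ.fderiv_of_isOpen h.isOpen (m := ∞) (by simp)).clm_apply contDiffOn_const

theorem differentiableAt (h : HypPatch φ U) (hu : u ∈ U) : DifferentiableAt ℝ φ u :=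
  h.differentiableAt_of_contDiffOn h.contDiffOn (by simp) hu

theorem differentiableAt_pd (h : HypPatch φ U) (i : Fin 2) (hu : u ∈ U) :
    DifferentiableAt ℝ (pd φ i) u :=
  h.differentiableAt_of_contDiffOn (h.contDiffOn_pd h.contDiffOn i) (by simp) hu

theorem pd_pd_comm (h : HypPatch φ U) (hu : u ∈ U) (i j : Fin 2) :
    pd (pd φ j) i u = pd (pd φ i) j u := by
  have hc := h.contDiffOn.contDiffAt (h.isOpen.mem_nhds hu)
  have hs : IsSymmSndFDerivAt ℝ φ u := hc.isSymmSndFDerivAt (by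
    rw [minSmoothness_of_isRCLikeNormedField]; exact WithTop.coe_le_coe.2 (le_top : (2 : ℕ∞) ≤ ⊤))
  have hd : DifferentiableAt ℝ (fderiv ℝ φ) u :=
    (hc.fderiv_right (m := ∞) (by simp)).differentiableAt (by simp)
  have pd_pd_eq (i j : Fin 2) : pd (pd φ j) i u =
      fderiv ℝ (fderiv ℝ φ) u (EuclideanSpace.single i 1) (EuclideanSpace.single j 1) := by
    rw [show pd φ j = fun u => fderiv ℝ φ u (EuclideanSpace.single j 1) from rfl, pd,
      fderiv_clm_apply hd (differentiableAt_const _)]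
    simp
  rw [pd_pd_eq, pd_pd_eq]
  exact hs _ _

theorem partials_eq_zero_of_eqOn_const (h : HypPatch φ U) {f : Plane → ℝ} {c : ℝ}
    (hf : ∀ v ∈ U, f v = c) (hu : u ∈ U) : partials f u = 0 := by
  have hloc : f =ᶠ[nhds u] fun _ => c := by
    filter_upwards [h.isOpen.mem_nhds hu] with v hv using hf v hv
  rw [partials_congr hloc]
  ext i
  simp [partials]

theorem lorentz_pd (h : HypPatch φ U) (hu : u ∈ U) (i : Fin 2) : lorentz (φ u) (pd φ i u) = 0 := by
  have hd := partials_lorentz (h.differentiableAt hu) (h.differentiableAt hu) i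
  rw [h.partials_eq_zero_of_eqOn_const (fun v hv => (h.mem v hv).1) hu, Pi.zero_apply,
    lorentz_comm _ (φ u)] at hd
  linarith

theorem lorentz_fderiv (h : HypPatch φ U) (hu : u ∈ U) (v : Plane) :
    lorentz (φ u) (fderiv ℝ φ u v) = 0 := by
  simp only [fderiv_apply_eq_sum_pd, lorentz_sum_right, lorentz_smul_right, h.lorentz_pd hu,
    mul_zero, Finset.sum_const_zero]

theorem posDef_firstForm (h : HypPatch φ U) (hu : u ∈ U) : (firstForm φ u).PosDef := by
  refine Matrix.PosDef.of_dotProduct_mulVec_pos (.ext fun i j => firstForm_comm φ u j i)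
    fun v hv => ?_
  have hne : fderiv ℝ φ u (WithLp.toLp 2 v) ≠ 0 := fun h0 =>
    hv (congrArg WithLp.ofLp (h.injective_fderiv u hu (h0.trans (map_zero _).symm)))
  simpa [lorentz_fderiv_fderiv] using lorentz_self_pos (h.mem u hu) (h.lorentz_fderiv hu _) hne

theorem det_pos (h : HypPatch φ U) (hu : u ∈ U) : 0 < (firstForm φ u).det :=
  (h.posDef_firstForm hu).det_pos

theorem sqrt_det_pos (h : HypPatch φ U) (hu : u ∈ U) : 0 < √(firstForm φ u).det :=
  Real.sqrt_pos.2 (h.det_pos hu)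

theorem lorentz_unitNormal (h : HypPatch φ U) (hu : u ∈ U) (w : Mink) :
    lorentz w (unitNormal φ u) =
      (√(firstForm φ u).det)⁻¹ * lorentz w (cross3 (φ u) (pd φ 0 u) (pd φ 1 u)) := by
  simp only [unitNormal]
  rw [lorentz_cross3_self (h.mem u hu).1 (h.lorentz_pd hu 0) (h.lorentz_pd hu 1), firstForm_det,
    lorentz_smul_right]

theorem lorentz_unitNormal_self (h : HypPatch φ U) (hu : u ∈ U) :
    lorentz (unitNormal φ u) (unitNormal φ u) = 1 := by
  have hpos := h.det_pos hu
  rw [firstForm_det,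
    ← lorentz_cross3_self (h.mem u hu).1 (h.lorentz_pd hu 0) (h.lorentz_pd hu 1)] at hpos
  simp only [unitNormal, lorentz_smul_left, lorentz_smul_right, ← mul_assoc, ← mul_inv]
  rw [Real.mul_self_sqrt hpos.le, inv_mul_cancel₀ hpos.ne']

theorem lorentz_apply_unitNormal (h : HypPatch φ U) (hu : u ∈ U) :
    lorentz (φ u) (unitNormal φ u) = 0 := by
  rw [h.lorentz_unitNormal hu, lorentz_left_cross3, mul_zero]

theorem lorentz_pd_unitNormal (h : HypPatch φ U) (hu : u ∈ U) (i : Fin 2) :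
    lorentz (pd φ i u) (unitNormal φ u) = 0 := by
  rw [h.lorentz_unitNormal hu]
  fin_cases i
  · simp [lorentz_mid_cross3]
  · simp [lorentz_right_cross3]

theorem eq_of_lorentz_frame_eq (h : HypPatch φ U) (hu : u ∈ U) {v w : Mink}
    (hφ : lorentz v (φ u) = lorentz w (φ u))
    (hpd : ∀ k, lorentz v (pd φ k u) = lorentz w (pd φ k u))
    (hν : lorentz v (unitNormal φ u) = lorentz w (unitNormal φ u)) : v = w := by
  rw [h.lorentz_unitNormal hu, h.lorentz_unitNormal hu] at hν
  refine eq_of_lorentz_eq (h.mem u hu).1 (h.lorentz_pd hu 0) (h.lorentz_pd hu 1) ?_ hφ (hpd 0)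
    (hpd 1) (mul_left_cancel₀ (inv_ne_zero (h.sqrt_det_pos hu).ne') hν)
  rw [← firstForm_det]
  exact (h.det_pos hu).ne'

theorem cometric_lorentz_pd (h : HypPatch φ U) (hu : u ∈ U) (w z : Mink) :
    cometric φ u (fun i => lorentz w (pd φ i u)) (fun i => lorentz z (pd φ i u)) =
      lorentz w z + lorentz w (φ u) * lorentz z (φ u) -
        lorentz w (unitNormal φ u) * lorentz z (unitNormal φ u) := by
  have hD := h.det_pos hu
  have hdec := lorentz_decomposition (h.mem u hu).1 (h.lorentz_pd hu 0) (h.lorentz_pd hu 1) w z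
  rw [← firstForm_det] at hdec
  have hs : (√(firstForm φ u).det)⁻¹ * (√(firstForm φ u).det)⁻¹ = (firstForm φ u).det⁻¹ := by
    rw [← mul_inv, Real.mul_self_sqrt hD.le]
  have hDinv := inv_mul_cancel₀ hD.ne'
  rw [cometric, inv_firstForm, h.lorentz_unitNormal hu, h.lorentz_unitNormal hu]
  simp [Matrix.mulVec, dotProduct, Fin.sum_univ_two]
  linear_combination -(firstForm φ u).det⁻¹ * hdec +
    lorentz w (cross3 (φ u) (pd φ 0 u) (pd φ 1 u)) *
      lorentz z (cross3 (φ u) (pd φ 0 u) (pd φ 1 u)) * hs +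
    (lorentz w z + lorentz w (φ u) * lorentz z (φ u)) * hDinv

end HypPatch

/-! ### The first variation formula in a parametrization -/

namespace HypPatch

variable {φ : Plane → Mink} {U : Set Plane} {u : Plane}

theorem contDiffOn_firstForm (h : HypPatch φ U) (i j : Fin 2) :
    ContDiffOn ℝ ∞ (fun u => firstForm φ u i j) U :=
  contDiffOn_lorentz (h.contDiffOn_pd h.contDiffOn i) (h.contDiffOn_pd h.contDiffOn j)

theorem contDiffOn_det (h : HypPatch φ U) : ContDiffOn ℝ ∞ (fun u => (firstForm φ u).det) U := by
  simp only [Matrix.det_fin_two]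
  have hg := h.contDiffOn_firstForm
  exact ((hg 0 0).mul (hg 1 1)).sub ((hg 0 1).mul (hg 1 0))

theorem contDiffOn_sqrt_det (h : HypPatch φ U) :
    ContDiffOn ℝ ∞ (fun u => √(firstForm φ u).det) U :=
  h.contDiffOn_det.sqrt fun _ hu => (h.det_pos hu).ne'

theorem contDiffOn_inv_firstForm (h : HypPatch φ U) (i j : Fin 2) :
    ContDiffOn ℝ ∞ (fun u => (firstForm φ u)⁻¹ i j) U := by
  have hg := h.contDiffOn_firstForm
  have hD := h.contDiffOn_det.inv fun u hu => (h.det_pos hu).ne'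
  simp only [inv_firstForm, Matrix.smul_apply, smul_eq_mul]
  refine hD.mul ?_
  fin_cases i <;> fin_cases j
  exacts [hg 1 1, (hg 0 1).neg, (hg 0 1).neg, hg 0 0]

theorem contDiffOn_conormal_coeff (h : HypPatch φ U) (i j : Fin 2) :
    ContDiffOn ℝ ∞ (fun u => √(firstForm φ u).det * (firstForm φ u)⁻¹ i j) U :=
  h.contDiffOn_sqrt_det.mul (h.contDiffOn_inv_firstForm i j)

theorem contDiffOn_conormal (h : HypPatch φ U) (i : Fin 2) : ContDiffOn ℝ ∞ (conormal φ i) U :=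
  ContDiffOn.sum fun j _ =>
    (h.contDiffOn_conormal_coeff i j).smul (h.contDiffOn_pd h.contDiffOn j)

theorem differentiableAt_conormal (h : HypPatch φ U) (i : Fin 2) (hu : u ∈ U) :
    DifferentiableAt ℝ (conormal φ i) u :=
  h.differentiableAt_of_contDiffOn (h.contDiffOn_conormal i) (by simp) hu

theorem lorentz_apply_conormal (h : HypPatch φ U) (hu : u ∈ U) (i : Fin 2) :
    lorentz (φ u) (conormal φ i u) = 0 := by
  simp only [conormal, lorentz_sum_right, lorentz_smul_right, h.lorentz_pd hu, mul_zero,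
    Finset.sum_const_zero]

theorem lorentz_pd_conormal (h : HypPatch φ U) (hu : u ∈ U) (i k : Fin 2) :
    lorentz (pd φ k u) (conormal φ i u) = if i = k then √(firstForm φ u).det else 0 := by
  have hinv : ((firstForm φ u)⁻¹ * firstForm φ u) i k = (1 : Matrix _ _ ℝ) i k := by
    rw [Matrix.nonsing_inv_mul _ (h.det_pos hu).ne'.isUnit]
  have hcol : (fun j => lorentz (pd φ k u) (pd φ j u)) = fun j => firstForm φ u j k :=
    funext fun j => firstForm_comm φ u k j
  have hmul : ((firstForm φ u)⁻¹ *ᵥ fun j => firstForm φ u j k) i = (1 : Matrix _ _ ℝ) i k := hinv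
  rw [lorentz_conormal, hcol, hmul, Matrix.one_apply, mul_ite, mul_one, mul_zero]

theorem partials_sqrt_det (h : HypPatch φ U) (hu : u ∈ U) (k : Fin 2) :
    partials (fun u => √(firstForm φ u).det) u k =
      ∑ i, lorentz (pd (pd φ i) k u) (conormal φ i u) := by
  have hD := h.det_pos hu
  have hg (i j : Fin 2) : DifferentiableAt ℝ (fun u => lorentz (pd φ i u) (pd φ j u)) u :=
    h.differentiableAt_of_contDiffOn (h.contDiffOn_firstForm i j) (by simp) hu
  have hdg (i j : Fin 2) := partials_lorentz (h.differentiableAt_pd i hu)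
    (h.differentiableAt_pd j hu) k
  have hdD : partials (fun u => (firstForm φ u).det) u k =
      2 * (lorentz (pd (pd φ 0) k u) (pd φ 0 u) * lorentz (pd φ 1 u) (pd φ 1 u) +
        lorentz (pd φ 0 u) (pd φ 0 u) * lorentz (pd (pd φ 1) k u) (pd φ 1 u) -
        lorentz (pd φ 0 u) (pd φ 1 u) *
          (lorentz (pd (pd φ 0) k u) (pd φ 1 u) + lorentz (pd (pd φ 1) k u) (pd φ 0 u))) := by
    simp only [firstForm_det, sq]
    rw [partials_sub ((hg 0 0).fun_mul (hg 1 1)) ((hg 0 1).fun_mul (hg 0 1)),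
      partials_mul (hg 0 0) (hg 1 1), partials_mul (hg 0 1) (hg 0 1)]
    simp only [Pi.sub_apply, Pi.add_apply, Pi.smul_apply, smul_eq_mul, hdg,
      lorentz_comm _ (pd (pd φ _) k u)]
    ring
  rw [partials_comp (Real.hasDerivAt_sqrt hD.ne').differentiableAt
    (h.differentiableAt_of_contDiffOn h.contDiffOn_det (by simp) hu),
    (Real.hasDerivAt_sqrt hD.ne').deriv, Pi.smul_apply, hdD]
  have hs : √(firstForm φ u).det * (firstForm φ u).det⁻¹ = (√(firstForm φ u).det)⁻¹ := by
    rw [← div_eq_mul_inv, Real.sqrt_div_self]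
  simp only [lorentz_conormal, inv_firstForm, Matrix.smul_mulVec, Pi.smul_apply, smul_eq_mul,
    ← mul_assoc, hs, Fin.sum_univ_two]
  simp [Matrix.mulVec, dotProduct, Fin.sum_univ_two]
  ring

theorem sum_lorentz_pd_conormal_apply (h : HypPatch φ U) (hu : u ∈ U) :
    ∑ i, lorentz (pd (conormal φ i) i u) (φ u) = -2 * √(firstForm φ u).det := by
  have hi (i : Fin 2) : lorentz (pd (conormal φ i) i u) (φ u) = -√(firstForm φ u).det := by
    have hd := partials_lorentz (h.differentiableAt hu) (h.differentiableAt_conormal i hu) i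
    rw [h.partials_eq_zero_of_eqOn_const (fun v hv => h.lorentz_apply_conormal hv i) hu,
      Pi.zero_apply, h.lorentz_pd_conormal hu, if_pos rfl, lorentz_comm (φ u)] at hd
    linarith
  simp only [hi, Fin.sum_univ_two]
  ring

theorem sum_lorentz_pd_conormal_pd (h : HypPatch φ U) (hu : u ∈ U) (k : Fin 2) :
    ∑ i, lorentz (pd (conormal φ i) i u) (pd φ k u) = 0 := by
  have hi (i : Fin 2) : lorentz (pd (conormal φ i) i u) (pd φ k u) =
      (if i = k then partials (fun u => √(firstForm φ u).det) u k else 0) -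
        lorentz (pd (pd φ i) k u) (conormal φ i u) := by
    have hd := partials_lorentz (h.differentiableAt_pd k hu) (h.differentiableAt_conormal i hu) i
    have hloc : partials (fun u => lorentz (pd φ k u) (conormal φ i u)) u i =
        if i = k then partials (fun u => √(firstForm φ u).det) u k else 0 := by
      split_ifs with hik
      · subst hik
        have heq : (fun u => lorentz (pd φ i u) (conormal φ i u)) =ᶠ[nhds u]
            fun u => √(firstForm φ u).det := by
          filter_upwards [h.isOpen.mem_nhds hu] with v hv
          rw [h.lorentz_pd_conormal hv, if_pos rfl]
        rw [partials, partials, heq.fderiv_eq]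
      · rw [h.partials_eq_zero_of_eqOn_const (c := 0) (fun v hv => ?_) hu, Pi.zero_apply]
        rw [h.lorentz_pd_conormal hv, if_neg hik]
    rw [hloc, h.pd_pd_comm hu, lorentz_comm (pd φ k u)] at hd
    linarith
  simp only [hi, Finset.sum_sub_distrib, Finset.sum_ite_eq', Finset.mem_univ, if_true,
    h.partials_sqrt_det hu, sub_self]

theorem sum_lorentz_pd_conormal_unitNormal (h : HypPatch φ U) (hu : u ∈ U) :
    ∑ i, lorentz (pd (conormal φ i) i u) (unitNormal φ u) =
      2 * √(firstForm φ u).det * patchMeanCurvature φ u := by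
  have hi (i : Fin 2) : lorentz (pd (conormal φ i) i u) (unitNormal φ u) =
      √(firstForm φ u).det * shapeOperator φ u i i := by
    have hterm (j : Fin 2) := pd_smul
      (h.differentiableAt_of_contDiffOn (h.contDiffOn_conormal_coeff i j) (by simp) hu)
      (h.differentiableAt_pd j hu) i
    have hξ : pd (conormal φ i) i u = _ :=
      pd_sum (fun j _ => (h.differentiableAt_of_contDiffOn (h.contDiffOn_conormal_coeff i j)
        (by simp) hu).fun_smul (h.differentiableAt_pd j hu)) i
    have hsecond (j : Fin 2) : lorentz (pd (pd φ j) i u) (unitNormal φ u) = secondForm φ u j i := by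
      rw [h.pd_pd_comm hu]; rfl
    rw [hξ]
    simp only [hterm, lorentz_sum_left, lorentz_add_left, lorentz_smul_left,
      h.lorentz_pd_unitNormal hu, mul_zero, add_zero, hsecond, shapeOperator, Matrix.mul_apply,
      Finset.mul_sum, mul_assoc]
  simp only [hi, patchMeanCurvature, Matrix.trace, Matrix.diag, ← Finset.mul_sum]
  ring

theorem sum_pd_conormal (h : HypPatch φ U) (hu : u ∈ U) :
    ∑ i, pd (conormal φ i) i u =
      (2 * √(firstForm φ u).det) • (φ u + patchMeanCurvatureVector φ u) := by
  refine h.eq_of_lorentz_frame_eq hu ?_ (fun k => ?_) ?_ <;>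
    simp only [lorentz_sum_left, lorentz_smul_left, lorentz_add_left, patchMeanCurvatureVector]
  · rw [h.sum_lorentz_pd_conormal_apply hu, (h.mem u hu).1, lorentz_comm,
      h.lorentz_apply_unitNormal hu]
    ring
  · rw [h.sum_lorentz_pd_conormal_pd hu, h.lorentz_pd hu, lorentz_comm,
      h.lorentz_pd_unitNormal hu]
    ring
  · rw [h.sum_lorentz_pd_conormal_unitNormal hu, h.lorentz_apply_unitNormal hu,
      h.lorentz_unitNormal_self hu]
    ring

theorem contDiffOn_patchMeanCurvatureVector (h : HypPatch φ U) :
    ContDiffOn ℝ ∞ (patchMeanCurvatureVector φ) U := by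
  have hne (u) (hu : u ∈ U) : 2 * √(firstForm φ u).det ≠ 0 :=
    mul_ne_zero two_ne_zero (h.sqrt_det_pos hu).ne'
  have hinv : ContDiffOn ℝ ∞ (fun u => (2 * √(firstForm φ u).det)⁻¹) U :=
    (contDiffOn_const.mul h.contDiffOn_sqrt_det).inv hne
  have hdiv : ContDiffOn ℝ ∞ (fun u => ∑ i, pd (conormal φ i) i u) U :=
    ContDiffOn.sum fun i _ => h.contDiffOn_pd (h.contDiffOn_conormal i) i
  refine ((hinv.smul hdiv).sub h.contDiffOn).congr fun u hu => ?_
  change _ = (2 * √(firstForm φ u).det)⁻¹ • (∑ i, pd (conormal φ i) i u) - φ u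
  rw [h.sum_pd_conormal hu, inv_smul_smul₀ (hne u hu), add_sub_cancel_left]

theorem lorentz_patchMeanCurvatureVector_self (h : HypPatch φ U) (hu : u ∈ U) :
    lorentz (patchMeanCurvatureVector φ u) (patchMeanCurvatureVector φ u) =
      patchMeanCurvature φ u ^ 2 := by
  rw [patchMeanCurvatureVector, lorentz_smul_left, lorentz_smul_right,
    h.lorentz_unitNormal_self hu]
  ring

end HypPatch

section CompactSupport

variable {X : Plane → ℝ} {U K : Set Plane}

theorem indicator_eventuallyEq_zero (hK : IsClosed K) (h0 : ∀ u ∈ U, u ∉ K → X u = 0) {u : Plane}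
    (hu : u ∉ K) : U.indicator X =ᶠ[nhds u] 0 := by
  filter_upwards [hK.isOpen_compl.mem_nhds hu] with v hv
  by_cases hvU : v ∈ U
  · rw [Set.indicator_of_mem hvU, h0 v hvU hv, Pi.zero_apply]
  · exact Set.indicator_of_notMem hvU X

theorem contDiff_indicator {n : WithTop ℕ∞} (hU : IsOpen U) (hK : IsClosed K) (hKU : K ⊆ U)
    (hX : ContDiffOn ℝ n X U) (h0 : ∀ u ∈ U, u ∉ K → X u = 0) :
    ContDiff ℝ n (U.indicator X) := by
  rw [contDiff_iff_contDiffAt]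
  intro u
  by_cases hu : u ∈ U
  · exact (hX.contDiffAt (hU.mem_nhds hu)).congr_of_eventuallyEq
      (Set.eqOn_indicator.eventuallyEq_of_mem (hU.mem_nhds hu))
  · exact contDiffAt_const.congr_of_eventuallyEq
      (indicator_eventuallyEq_zero hK h0 fun h => hu (hKU h))

theorem partials_indicator (hU : IsOpen U) (hK : IsClosed K) (hKU : K ⊆ U)
    (h0 : ∀ u ∈ U, u ∉ K → X u = 0) (i : Fin 2) :
    (fun u => partials (U.indicator X) u i) = U.indicator fun u => partials X u i := by
  ext u
  by_cases hu : u ∈ U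
  · rw [Set.indicator_of_mem hu, partials, partials,
      (Set.eqOn_indicator.eventuallyEq_of_mem (hU.mem_nhds hu)).fderiv_eq]
  · rw [Set.indicator_of_notMem hu, partials,
      (indicator_eventuallyEq_zero hK h0 fun h => hu (hKU h)).fderiv_eq]
    simp

theorem integral_fderiv_apply_eq_zero {E : Type*} [NormedAddCommGroup E] [NormedSpace ℝ E]
    [FiniteDimensional ℝ E] [MeasurableSpace E] [BorelSpace E] (μ : Measure E)
    [μ.IsAddHaarMeasure] {f : E → ℝ} (hf : ContDiff ℝ 1 f) (hsupp : HasCompactSupport f) (v : E) :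
    Integrable (fun u => fderiv ℝ f u v) μ ∧ ∫ u, fderiv ℝ f u v ∂μ = 0 := by
  have hint : Integrable (fun u => fderiv ℝ f u v) μ :=
    ((hf.continuous_fderiv (by simp)).clm_apply continuous_const).integrable_of_hasCompactSupport
      (hsupp.fderiv_apply ℝ v)
  have hparts := integral_mul_fderiv_eq_neg_fderiv_mul_of_integrable (μ := μ)
    (f := fun _ => (1 : ℝ)) (g := f) (v := v) (by simp) (by simpa using hint)
    (by simpa using hf.continuous.integrable_of_hasCompactSupport hsupp)
    (fun _ _ => differentiableAt_const _) (fun x _ => hf.differentiable (by simp) x)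
  exact ⟨hint, by simpa using hparts⟩

theorem integral_partials_eq_zero (hU : IsOpen U) (hK : IsCompact K) (hKU : K ⊆ U)
    (hX : ContDiffOn ℝ 1 X U) (h0 : ∀ u ∈ U, u ∉ K → X u = 0) (i : Fin 2) :
    IntegrableOn (fun u => partials X u i) U ∧ ∫ u in U, partials X u i = 0 := by
  have hsupp : HasCompactSupport (U.indicator X) :=
    .intro hK fun u hu => (indicator_eventuallyEq_zero hK.isClosed h0 hu).eq_of_nhds
  have hzero := integral_fderiv_apply_eq_zero volume
    (contDiff_indicator hU hK.isClosed hKU hX h0) hsupp (EuclideanSpace.single i 1)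
  change Integrable (fun u => partials (U.indicator X) u i) ∧
    ∫ u, partials (U.indicator X) u i = 0 at hzero
  simp only [partials_indicator hU hK.isClosed hKU h0] at hzero
  rwa [integrable_indicator_iff hU.measurableSet, integral_indicator hU.measurableSet] at hzero

end CompactSupport

/-- The divergence of the vector field `ψ ∇f` on a parametrized surface, where `f = ⟨q, φ⟩`,
expanded by `Δf = 2⟨q, φ + H ν⟩`. -/
noncomputable def patchDiv (φ : Plane → Mink) (q : Mink) (ψ : Plane → ℝ) (u : Plane) : ℝ :=
  ψ u * (2 * lorentz q (φ u + patchMeanCurvatureVector φ u)) +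
    cometric φ u (partials ψ u) (partials (fun u => lorentz q (φ u)) u)

theorem patchDiv_congr (φ : Plane → Mink) (q : Mink) {ψ ψ' : Plane → ℝ} {u : Plane}
    (h : ψ =ᶠ[nhds u] ψ') : patchDiv φ q ψ u = patchDiv φ q ψ' u := by
  rw [patchDiv, patchDiv, h.eq_of_nhds, partials_congr h]

theorem patchDiv_sum (φ : Plane → Mink) (q : Mink) {ι : Type*} {s : Finset ι}
    {ψ : ι → Plane → ℝ} {u : Plane} (hψ : ∀ j ∈ s, DifferentiableAt ℝ (ψ j) u) :
    patchDiv φ q (fun u => ∑ j ∈ s, ψ j u) u = ∑ j ∈ s, patchDiv φ q (ψ j) u := by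
  have hpartials : partials (fun u => ∑ j ∈ s, ψ j u) u = ∑ j ∈ s, partials (ψ j) u := by
    ext i
    simp [partials, fderiv_fun_sum hψ]
  simp only [patchDiv, hpartials, cometric, sum_dotProduct, Finset.sum_add_distrib, Finset.sum_mul]

namespace HypPatch

variable {φ : Plane → Mink} {U : Set Plane} {u : Plane}

theorem sum_partials_mul_conormal (h : HypPatch φ U) {ψ : Plane → ℝ} (hψ : ContDiffOn ℝ 1 ψ U)
    (hu : u ∈ U) (q : Mink) :
    ∑ i, partials (fun u => ψ u * lorentz q (conormal φ i u)) u i =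
      √(firstForm φ u).det * patchDiv φ q ψ u := by
  have hdψ := h.differentiableAt_of_contDiffOn hψ one_ne_zero hu
  have hterm (i : Fin 2) : partials (fun u => ψ u * lorentz q (conormal φ i u)) u i =
      ψ u * lorentz q (pd (conormal φ i) i u) + partials ψ u i * lorentz q (conormal φ i u) := by
    have hξ := h.differentiableAt_conormal i hu
    have hdξ : DifferentiableAt ℝ (fun u => lorentz q (conormal φ i u)) u :=
      (lorentzCLM q).differentiableAt.comp u hξ
    rw [partials_mul hdψ hdξ, partials_lorentz_const q hξ]
    simp [mul_comm]
  simp only [hterm, Finset.sum_add_distrib, sum_mul_lorentz_conormal, ← Finset.mul_sum,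
    ← lorentz_sum_right, h.sum_pd_conormal hu, lorentz_smul_right,
    patchDiv, partials_lorentz_const q (h.differentiableAt hu)]
  ring

theorem patchDiv_comp_lorentz (h : HypPatch φ U) (hu : u ∈ U) (q : Mink) {k : ℝ → ℝ}
    (hk : DifferentiableAt ℝ k (lorentz q (φ u))) :
    patchDiv φ q (fun u => k (lorentz q (φ u))) u =
      k (lorentz q (φ u)) * (2 * lorentz q (φ u) +
        2 * patchMeanCurvature φ u * lorentz q (unitNormal φ u)) +
      deriv k (lorentz q (φ u)) *
        (lorentz q q + lorentz q (φ u) ^ 2 - lorentz q (unitNormal φ u) ^ 2) := by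
  have hd := h.differentiableAt hu
  have hgrad := h.cometric_lorentz_pd hu q q
  rw [cometric] at hgrad
  have hheight : DifferentiableAt ℝ (fun u => lorentz q (φ u)) u :=
    (lorentzCLM q).differentiableAt.comp u hd
  rw [patchDiv, partials_comp hk hheight,
    partials_lorentz_const q hd, cometric, smul_dotProduct, hgrad, patchMeanCurvatureVector,
    lorentz_add_right, lorentz_smul_right, smul_eq_mul]
  ring

theorem continuousOn_patchDiv (h : HypPatch φ U) {ψ : Plane → ℝ} (hψ : ContDiffOn ℝ 1 ψ U)
    (q : Mink) : ContinuousOn (patchDiv φ q ψ) U := by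
  have hheight : ContDiffOn ℝ 1 (fun u => lorentz q (φ u)) U :=
    contDiffOn_lorentz contDiffOn_const (h.contDiffOn.of_le (by exact_mod_cast le_top))
  have hpartials {χ : Plane → ℝ} (hχ : ContDiffOn ℝ 1 χ U) (i : Fin 2) :
      ContinuousOn (fun u => partials χ u i) U :=
    (hχ.continuousOn_fderiv_of_isOpen h.isOpen le_rfl).clm_apply continuousOn_const
  have hlap : ContinuousOn (fun u => lorentz q (φ u + patchMeanCurvatureVector φ u)) U :=
    (contDiffOn_lorentz contDiffOn_const
      (h.contDiffOn.add h.contDiffOn_patchMeanCurvatureVector)).continuousOn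
  refine (hψ.continuousOn.mul (continuousOn_const.mul hlap)).add ?_
  simp only [cometric, dotProduct, Matrix.mulVec]
  exact continuousOn_finsetSum _ fun i _ => (hpartials hψ i).mul <|
    continuousOn_finsetSum _ fun j _ =>
      (h.contDiffOn_inv_firstForm i j).continuousOn.mul (hpartials hheight j)

theorem integral_patchDiv (h : HypPatch φ U) {K : Set Plane} (hK : IsCompact K)
    (hKU : K ⊆ U) {ψ : Plane → ℝ} (hψ : ContDiffOn ℝ 1 ψ U) (h0 : ∀ u ∈ U, u ∉ K → ψ u = 0)
    (q : Mink) :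
    ∫ u in U, √(firstForm φ u).det * patchDiv φ q ψ u = 0 := by
  have hX (i : Fin 2) : ContDiffOn ℝ 1 (fun u => ψ u * lorentz q (conormal φ i u)) U :=
    hψ.mul (contDiffOn_lorentz contDiffOn_const
      ((h.contDiffOn_conormal i).of_le (by exact_mod_cast le_top)))
  have hzero (i : Fin 2) := integral_partials_eq_zero h.isOpen hK hKU (hX i)
    (fun u hu huK => by rw [h0 u hu huK, zero_mul]) i
  rw [← setIntegral_congr_fun h.isOpen.measurableSet
    fun u hu => h.sum_partials_mul_conormal hψ hu q,
    integral_finsetSum _ fun i _ => (hzero i).1]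
  simp only [(hzero _).2, Finset.sum_const_zero]

end HypPatch

/-! ### Change of coordinates -/

/-- The Jacobian matrix of a map of the coordinate plane. -/
noncomputable def jacobian (τ : Plane → Plane) (u : Plane) : Matrix (Fin 2) (Fin 2) ℝ :=
  Matrix.of fun j i => fderiv ℝ τ u (EuclideanSpace.single i 1) j

section Jacobian

variable {τ : Plane → Plane} {u : Plane}

theorem det_fderiv_eq_det_jacobian (τ : Plane → Plane) (u : Plane) :
    (fderiv ℝ τ u).det = (jacobian τ u).det := by
  rw [ContinuousLinearMap.det,
    ← LinearMap.det_toMatrix (EuclideanSpace.basisFun (Fin 2) ℝ).toBasis]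
  rfl

theorem pd_comp {φ : Plane → Mink} (hφ : DifferentiableAt ℝ φ (τ u))
    (hτ : DifferentiableAt ℝ τ u) (i : Fin 2) :
    pd (φ ∘ τ) i u = ∑ j, jacobian τ u j i • pd φ j (τ u) := by
  rw [pd, fderiv_comp u hφ hτ, ContinuousLinearMap.comp_apply, fderiv_apply_eq_sum_pd]
  rfl

theorem partials_comp_eq_vecMul {f : Plane → ℝ} (hf : DifferentiableAt ℝ f (τ u))
    (hτ : DifferentiableAt ℝ τ u) :
    partials (f ∘ τ) u = partials f (τ u) ᵥ* jacobian τ u := by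
  ext i
  rw [partials, fderiv_comp u hf hτ, ContinuousLinearMap.comp_apply,
    plane_eq_sum (fderiv ℝ τ u _), map_sum]
  simp [Matrix.vecMul, dotProduct, partials, jacobian, mul_comm]

theorem cross3_sum_smul (J : Matrix (Fin 2) (Fin 2) ℝ) (w : Mink) (a : Fin 2 → Mink) :
    cross3 w (∑ j, J j 0 • a j) (∑ j, J j 1 • a j) = J.det • cross3 w (a 0) (a 1) := by
  refine lorentz_ext fun z => ?_
  rw [lorentz_smul_left, lorentz_comm, lorentz_comm (cross3 w (a 0) (a 1)), lorentz_cross3,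
    lorentz_cross3, Matrix.det_fin_two]
  simp [Matrix.det_succ_row_zero, Fin.sum_univ_succ, Fin.succAbove]
  ring

end Jacobian

/-- `φ` is near `u` the reparametrization of `φ'` by the `C²` map `τ`. -/
structure Reparam (φ φ' : Plane → Mink) (τ : Plane → Plane) (u : Plane) : Prop where
  contDiffAt : ContDiffAt ℝ 2 τ u
  eventuallyEq : φ =ᶠ[nhds u] φ' ∘ τ

namespace Reparam

variable {φ φ' : Plane → Mink} {U U' : Set Plane} {u : Plane} {τ : Plane → Plane}

theorem apply_eq (r : Reparam φ φ' τ u) : φ u = φ' (τ u) := r.eventuallyEq.self_of_nhds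

theorem differentiableAt (r : Reparam φ φ' τ u) : DifferentiableAt ℝ τ u :=
  r.contDiffAt.differentiableAt (by simp)

theorem eventually (r : Reparam φ φ' τ u) : ∀ᶠ v in nhds u, Reparam φ φ' τ v := by
  filter_upwards [r.contDiffAt.eventually (by decide), r.eventuallyEq.eventually_nhds]
    with v hτ heq using ⟨hτ, heq⟩

theorem pd_eq (r : Reparam φ φ' τ u) (h' : HypPatch φ' U') (hu' : τ u ∈ U') (i : Fin 2) :
    pd φ i u = ∑ j, jacobian τ u j i • pd φ' j (τ u) := by
  rw [pd, r.eventuallyEq.fderiv_eq]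
  exact pd_comp (h'.differentiableAt hu') r.differentiableAt i

theorem differentiableAt_jacobian (r : Reparam φ φ' τ u) (i j : Fin 2) :
    DifferentiableAt ℝ (fun v => jacobian τ v j i) u := by
  have hd : DifferentiableAt ℝ (fderiv ℝ τ) u :=
    (r.contDiffAt.fderiv_right (m := 1) (by norm_num)).differentiableAt (by simp)
  have hcol : DifferentiableAt ℝ (fun v => fderiv ℝ τ v (EuclideanSpace.single i 1)) u :=
    hd.clm_apply (differentiableAt_const _)
  exact (EuclideanSpace.proj (𝕜 := ℝ) j).differentiableAt.comp u hcol

theorem pd_pd_eq (r : Reparam φ φ' τ u) (h' : HypPatch φ' U') (hu' : τ u ∈ U') (i k : Fin 2) :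
    pd (pd φ k) i u = ∑ l, (jacobian τ u l k • ∑ j, jacobian τ u j i • pd (pd φ' l) j (τ u) +
      partials (fun v => jacobian τ v l k) u i • pd φ' l (τ u)) := by
  have hloc : pd φ k =ᶠ[nhds u] fun v => ∑ l, jacobian τ v l k • (pd φ' l ∘ τ) v := by
    filter_upwards [r.eventually,
      r.differentiableAt.continuousAt.preimage_mem_nhds (h'.isOpen.mem_nhds hu')] with v hv hv'
    exact hv.pd_eq h' hv' k
  have hφ' (l : Fin 2) := h'.differentiableAt_pd l hu'
  have hcomp (l : Fin 2) : DifferentiableAt ℝ (pd φ' l ∘ τ) u := (hφ' l).comp u r.differentiableAt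
  have hJ := r.differentiableAt_jacobian k
  rw [pd, hloc.fderiv_eq, ← pd, pd_sum fun l _ => (hJ l).fun_smul (hcomp l)]
  refine Finset.sum_congr rfl fun l _ => ?_
  rw [← pd_comp (hφ' l) r.differentiableAt]
  exact pd_smul (hJ l) (hcomp l) i

theorem firstForm_eq (r : Reparam φ φ' τ u) (h' : HypPatch φ' U') (hu' : τ u ∈ U') :
    firstForm φ u = (jacobian τ u)ᵀ * firstForm φ' (τ u) * jacobian τ u := by
  ext i k
  simp only [firstForm, Matrix.of_apply, r.pd_eq h' hu', lorentz_sum_left, lorentz_sum_right,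
    lorentz_smul_left, lorentz_smul_right, Matrix.mul_apply, Matrix.transpose_apply,
    Finset.sum_mul, Finset.mul_sum]
  refine Finset.sum_congr rfl fun _ _ => Finset.sum_congr rfl fun _ _ => ?_
  ring

theorem det_eq (r : Reparam φ φ' τ u) (h' : HypPatch φ' U') (hu' : τ u ∈ U') :
    (firstForm φ u).det = (jacobian τ u).det ^ 2 * (firstForm φ' (τ u)).det := by
  rw [r.firstForm_eq h' hu', Matrix.det_mul, Matrix.det_mul, Matrix.det_transpose]
  ring

theorem sqrt_det_eq (r : Reparam φ φ' τ u) (h' : HypPatch φ' U') (hu' : τ u ∈ U') :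
    √(firstForm φ u).det = |(jacobian τ u).det| * √(firstForm φ' (τ u)).det := by
  rw [r.det_eq h' hu', Real.sqrt_mul (sq_nonneg _), Real.sqrt_sq_eq_abs]

theorem det_jacobian_ne_zero (r : Reparam φ φ' τ u) (h : HypPatch φ U) (hu : u ∈ U)
    (h' : HypPatch φ' U') (hu' : τ u ∈ U') : (jacobian τ u).det ≠ 0 := by
  intro h0
  have hD := h.det_pos hu
  simp [r.det_eq h' hu', h0] at hD

theorem unitNormal_eq (r : Reparam φ φ' τ u) (h : HypPatch φ U) (hu : u ∈ U)
    (h' : HypPatch φ' U') (hu' : τ u ∈ U') :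
    unitNormal φ u = (|(jacobian τ u).det|⁻¹ * (jacobian τ u).det) • unitNormal φ' (τ u) := by
  refine lorentz_ext fun w => ?_
  rw [lorentz_comm, lorentz_smul_left, lorentz_comm (unitNormal _ _), h.lorentz_unitNormal hu,
    h'.lorentz_unitNormal hu', r.sqrt_det_eq h' hu', r.pd_eq h' hu', r.pd_eq h' hu', r.apply_eq,
    cross3_sum_smul, lorentz_smul_right, mul_inv]
  ring

theorem secondForm_eq (r : Reparam φ φ' τ u) (h : HypPatch φ U) (hu : u ∈ U)
    (h' : HypPatch φ' U') (hu' : τ u ∈ U') :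
    secondForm φ u = (|(jacobian τ u).det|⁻¹ * (jacobian τ u).det) •
      ((jacobian τ u)ᵀ * secondForm φ' (τ u) * jacobian τ u) := by
  ext i k
  simp only [secondForm, Matrix.of_apply, r.unitNormal_eq h hu h' hu', lorentz_smul_right,
    r.pd_pd_eq h' hu', lorentz_sum_left, lorentz_add_left, lorentz_smul_left,
    h'.lorentz_pd_unitNormal hu', mul_zero, add_zero, Matrix.smul_apply, Matrix.mul_apply,
    Matrix.transpose_apply, smul_eq_mul]
  congr 1
  exact Finset.sum_congr rfl fun _ _ => mul_comm _ _

theorem shapeOperator_eq (r : Reparam φ φ' τ u) (h : HypPatch φ U) (hu : u ∈ U)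
    (h' : HypPatch φ' U') (hu' : τ u ∈ U') :
    shapeOperator φ u = (|(jacobian τ u).det|⁻¹ * (jacobian τ u).det) •
      ((jacobian τ u)⁻¹ * shapeOperator φ' (τ u) * jacobian τ u) := by
  have hJ : IsUnit (jacobian τ u)ᵀ.det := by
    rw [Matrix.det_transpose]
    exact (r.det_jacobian_ne_zero h hu h' hu').isUnit
  rw [shapeOperator, shapeOperator, r.firstForm_eq h' hu', r.secondForm_eq h hu h' hu',
    Matrix.mul_inv_rev, Matrix.mul_inv_rev, Matrix.mul_smul]
  simp only [Matrix.mul_assoc, Matrix.nonsing_inv_mul_cancel_left _ _ hJ]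

theorem patchMeanCurvatureVector_eq (r : Reparam φ φ' τ u) (h : HypPatch φ U) (hu : u ∈ U)
    (h' : HypPatch φ' U') (hu' : τ u ∈ U') :
    patchMeanCurvatureVector φ u = patchMeanCurvatureVector φ' (τ u) := by
  have hJ := r.det_jacobian_ne_zero h hu h' hu'
  have htrace : ((jacobian τ u)⁻¹ * shapeOperator φ' (τ u) * jacobian τ u).trace =
      (shapeOperator φ' (τ u)).trace := by
    rw [Matrix.mul_assoc, Matrix.trace_mul_comm, Matrix.mul_assoc,
      Matrix.mul_nonsing_inv _ hJ.isUnit, Matrix.mul_one]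
  have hsign : |(jacobian τ u).det|⁻¹ * (jacobian τ u).det *
      (|(jacobian τ u).det|⁻¹ * (jacobian τ u).det) = 1 := by
    rw [mul_mul_mul_comm, ← abs_mul_abs_self (jacobian τ u).det, ← mul_inv]
    exact inv_mul_cancel₀ (mul_ne_zero (abs_ne_zero.2 hJ) (abs_ne_zero.2 hJ))
  simp only [patchMeanCurvatureVector, patchMeanCurvature, r.shapeOperator_eq h hu h' hu',
    r.unitNormal_eq h hu h' hu', Matrix.trace_smul, htrace, smul_eq_mul, smul_smul]
  congr 1
  linear_combination (shapeOperator φ' (τ u)).trace / 2 * hsign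

theorem cometric_eq (r : Reparam φ φ' τ u) (h : HypPatch φ U) (hu : u ∈ U)
    (h' : HypPatch φ' U') (hu' : τ u ∈ U') (a b : Fin 2 → ℝ) :
    cometric φ u (a ᵥ* jacobian τ u) (b ᵥ* jacobian τ u) = cometric φ' (τ u) a b := by
  have hJ := (r.det_jacobian_ne_zero h hu h' hu').isUnit
  have hJ' : IsUnit (jacobian τ u)ᵀ.det := by rwa [Matrix.det_transpose]
  rw [cometric, cometric, r.firstForm_eq h' hu', Matrix.mul_inv_rev, Matrix.mul_inv_rev,
    ← Matrix.mulVec_transpose (jacobian τ u) b, Matrix.dotProduct_mulVec, Matrix.vecMul_vecMul,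
    ← Matrix.dotProduct_mulVec, Matrix.mulVec_mulVec]
  rw [Matrix.mul_nonsing_inv_cancel_left _ _ hJ, Matrix.nonsing_inv_mul_cancel_right _ _ hJ']

theorem patchDiv_eq (r : Reparam φ φ' τ u) (h : HypPatch φ U) (hu : u ∈ U)
    (h' : HypPatch φ' U') (hu' : τ u ∈ U') {ψ : Plane → ℝ} (hψ : DifferentiableAt ℝ ψ (τ u))
    (q : Mink) : patchDiv φ q (ψ ∘ τ) u = patchDiv φ' q ψ (τ u) := by
  have hheight : partials (fun u => lorentz q (φ u)) u =
      partials (fun v => lorentz q (φ' v)) (τ u) ᵥ* jacobian τ u := by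
    have hd : DifferentiableAt ℝ (fun v => lorentz q (φ' v)) (τ u) :=
      (lorentzCLM q).differentiableAt.comp _ (h'.differentiableAt hu')
    rw [← partials_comp_eq_vecMul hd r.differentiableAt]
    exact partials_congr (r.eventuallyEq.fun_comp (lorentz q))
  rw [patchDiv, patchDiv, hheight, partials_comp_eq_vecMul hψ r.differentiableAt,
    r.cometric_eq h hu h' hu', r.apply_eq, r.patchMeanCurvatureVector_eq h hu h' hu',
    Function.comp_apply]

end Reparam

/-! ### The area measure in charts -/

section Charts

variable {M : Type*} [TopologicalSpace M] [ChartedSpace Plane M] [IsManifold (𝓡 2) ∞ M]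
  {F : M → Mink} {e e' : OpenPartialHomeomorph M Plane}

theorem IsHypImmersion.hypPatch (hF : IsHypImmersion F) (he : e ∈ atlas Plane M) :
    HypPatch (F ∘ e.symm) e.target where
  isOpen := e.open_target
  contDiffOn := contMDiffOn_iff_contDiffOn.1 <| hF.smooth.comp_contMDiffOn <|
    contMDiffOn_symm_of_mem_maximalAtlas (IsManifold.subset_maximalAtlas he)
  mem u _ := hF.mem _
  injective_fderiv u hu := by
    have hd : e.MDifferentiable (𝓡 2) (𝓡 2) := mdifferentiable_of_mem_atlas he
    rw [← mfderiv_eq_fderiv,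
      mfderiv_comp u (hF.smooth.mdifferentiableAt (by simp)) (hd.mdifferentiableAt_symm hu)]
    exact (hF.injective_mfderiv _).comp (hd.symm.mfderiv_injective hu)

theorem IsHypImmersion.aemeasurable_ofReal_sqrt_det (hF : IsHypImmersion F)
    (he : e ∈ atlas Plane M) :
    AEMeasurable (fun u => ENNReal.ofReal √(firstForm (F ∘ e.symm) u).det)
      (volume.restrict e.target) :=
  ((hF.hypPatch he).contDiffOn_sqrt_det.continuousOn.aemeasurable
    e.open_target.measurableSet).ennreal_ofReal

theorem reparam_of_mem_atlas (F : M → Mink) (he : e ∈ atlas Plane M) (he' : e' ∈ atlas Plane M)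
    {u : Plane} (hu : u ∈ e.target) (hu' : e.symm u ∈ e'.source) :
    Reparam (F ∘ e.symm) (F ∘ e'.symm) (e' ∘ e.symm) u where
  contDiffAt := by
    have hsymm : ContMDiffAt (𝓡 2) (𝓡 2) ∞ e.symm u :=
      (contMDiffOn_symm_of_mem_maximalAtlas
        (IsManifold.subset_maximalAtlas he)).contMDiffAt (e.open_target.mem_nhds hu)
    have hchart : ContMDiffAt (𝓡 2) (𝓡 2) ∞ e' (e.symm u) :=
      (contMDiffOn_of_mem_maximalAtlas
        (IsManifold.subset_maximalAtlas he')).contMDiffAt (e'.open_source.mem_nhds hu')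
    exact (contMDiffAt_iff_contDiffAt.1 (hchart.comp u hsymm)).of_le
      (WithTop.coe_le_coe.2 (le_top : (2 : ℕ∞) ≤ ⊤))
  eventuallyEq := by
    filter_upwards [(e.symm.continuousAt hu).preimage_mem_nhds (e'.open_source.mem_nhds hu')]
      with v hv
    simp only [Function.comp_apply, e'.left_inv hv]

end Charts

section ChartArea

variable {M : Type*} [TopologicalSpace M] [MeasurableSpace M] [BorelSpace M]

theorem aemeasurable_symm (e : OpenPartialHomeomorph M Plane) :
    AEMeasurable e.symm (volume.restrict e.target) :=
  e.continuousOn_symm.aemeasurable e.open_target.measurableSet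

theorem aemeasurable_symm_withDensity (e : OpenPartialHomeomorph M Plane) (f : Plane → ENNReal) :
    AEMeasurable e.symm ((volume.restrict e.target).withDensity f) :=
  (aemeasurable_symm e).mono_ac (withDensity_absolutelyContinuous _ f)

theorem measurableSet_target_inter_preimage (e : OpenPartialHomeomorph M Plane) {A : Set M}
    (hA : MeasurableSet A) : MeasurableSet (e.target ∩ e.symm ⁻¹' A) := by
  have hm := (continuousOn_iff_continuous_domRestrict.1 e.continuousOn_symm).measurable hA
  rw [← Subtype.image_preimage_coe]
  exact e.open_target.measurableSet.subtype_image hm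

theorem chartArea_apply (F : M → Mink) (e : OpenPartialHomeomorph M Plane) {A : Set M}
    (hA : MeasurableSet A) :
    chartArea F e A = ∫⁻ u in e.target ∩ e.symm ⁻¹' A,
      ENNReal.ofReal √(firstForm (F ∘ e.symm) u).det := by
  rw [chartArea, Measure.map_apply_of_aemeasurable (aemeasurable_symm_withDensity e _) hA,
    withDensity_apply', Measure.restrict_restrict' e.open_target.measurableSet, Set.inter_comm]

theorem chartArea_compl_source (F : M → Mink) (e : OpenPartialHomeomorph M Plane) :
    chartArea F e e.sourceᶜ = 0 := by
  have hempty : e.target ∩ e.symm ⁻¹' e.sourceᶜ = ∅ :=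
    Set.eq_empty_of_forall_notMem fun u hu => hu.2 (e.map_target hu.1)
  rw [chartArea_apply F e e.open_source.measurableSet.compl, hempty, Measure.restrict_empty,
    lintegral_zero_measure]

theorem chartArea_restrict_source (F : M → Mink) (e : OpenPartialHomeomorph M Plane) :
    (chartArea F e).restrict e.source = chartArea F e :=
  Measure.restrict_eq_self_of_ae_mem (ae_iff.2 (chartArea_compl_source F e))

variable [ChartedSpace Plane M] [IsManifold (𝓡 2) ∞ M]
  {F : M → Mink} {e e' : OpenPartialHomeomorph M Plane}

theorem IsHypImmersion.chartArea_eq (hF : IsHypImmersion F) (he : e ∈ atlas Plane M)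
    (he' : e' ∈ atlas Plane M) {A : Set M} (hA : MeasurableSet A) (hAe : A ⊆ e.source)
    (hAe' : A ⊆ e'.source) : chartArea F e A = chartArea F e' A := by
  have hm := measurableSet_target_inter_preimage e hA
  rw [chartArea_apply F e hA, chartArea_apply F e' hA]
  have himage : (e' ∘ e.symm) '' (e.target ∩ e.symm ⁻¹' A) = e'.target ∩ e'.symm ⁻¹' A := by
    rw [← e.image_eq_target_inter_inv_preimage hAe, ← e'.image_eq_target_inter_inv_preimage hAe',
      Set.image_comp]
    exact congrArg _ (e.toPartialEquiv.symm_image_image_of_subset_source hAe)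
  have hrep (u) (hu : u ∈ e.target ∩ e.symm ⁻¹' A) :
      Reparam (F ∘ e.symm) (F ∘ e'.symm) (e' ∘ e.symm) u :=
    reparam_of_mem_atlas F he he' hu.1 (hAe' hu.2)
  have hinj : Set.InjOn (e' ∘ e.symm) (e.target ∩ e.symm ⁻¹' A) := fun u hu v hv huv =>
    e.symm.injOn hu.1 hv.1 (e'.injOn (hAe' hu.2) (hAe' hv.2) huv)
  rw [← himage, lintegral_image_eq_lintegral_abs_det_fderiv_mul volume hm
    (fun u hu => (hrep u hu).differentiableAt.hasFDerivAt.hasFDerivWithinAt) hinj]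
  refine setLIntegral_congr_fun hm fun u hu => ?_
  rw [det_fderiv_eq_det_jacobian, ← ENNReal.ofReal_mul (abs_nonneg _),
    (hrep u hu).sqrt_det_eq (hF.hypPatch he') (e'.map_source (hAe' hu.2))]

theorem IsHypImmersion.chartArea_inter_source_le (hF : IsHypImmersion F) (he : e ∈ atlas Plane M)
    (he' : e' ∈ atlas Plane M) {A : Set M} (hA : MeasurableSet A) :
    chartArea F e' (A ∩ e.source) ≤ chartArea F e A := by
  have hm : MeasurableSet (A ∩ e.source ∩ e'.source) :=
    (hA.inter e.open_source.measurableSet).inter e'.open_source.measurableSet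
  rw [← chartArea_restrict_source F e', Measure.restrict_apply'
    e'.open_source.measurableSet, hF.chartArea_eq he' he hm Set.inter_subset_right
      (Set.inter_subset_left.trans Set.inter_subset_right)]
  exact measure_mono (Set.inter_subset_left.trans Set.inter_subset_left)

theorem IsHypImmersion.areaMeasure_restrict_le (hF : IsHypImmersion F) (he : e ∈ atlas Plane M) :
    (areaMeasure F).restrict e.source ≤ chartArea F e := by
  have hms := e.open_source.measurableSet
  have hle : areaMeasure F ≤ chartArea F e + (⊤ : Measure M).restrict e.sourceᶜ := by
    refine iSup₂_le fun e' he' => Measure.le_intro fun A hA _ => ?_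
    rw [← measure_inter_add_sdiff A hms, Measure.add_apply, Measure.restrict_apply hA]
    exact add_le_add (hF.chartArea_inter_source_le he he' hA) (Measure.le_iff'.1 le_top _)
  refine (Measure.restrict_mono le_rfl hle).trans ?_
  rw [Measure.restrict_add, Measure.restrict_restrict hms, Set.inter_compl_self,
    Measure.restrict_empty, add_zero]
  exact Measure.restrict_le_self

theorem IsHypImmersion.areaMeasure_restrict (hF : IsHypImmersion F) (he : e ∈ atlas Plane M) :
    (areaMeasure F).restrict e.source = chartArea F e := by
  refine le_antisymm (hF.areaMeasure_restrict_le he) ?_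
  rw [← chartArea_restrict_source F e]
  exact Measure.restrict_mono le_rfl (le_iSup₂_of_le e he le_rfl)

theorem IsHypImmersion.isLocallyFiniteMeasure (hF : IsHypImmersion F) :
    IsLocallyFiniteMeasure (areaMeasure F) := by
  refine ⟨fun x => ?_⟩
  set e := chartAt Plane x
  have he : e ∈ atlas Plane M := chart_mem_atlas Plane x
  have hx : x ∈ e.source := mem_chart_source Plane x
  obtain ⟨K, hK, hxK, hKt⟩ := exists_compact_subset e.open_target (e.map_source hx)
  have hopen := e.isOpen_inter_preimage (isOpen_interior (s := K))
  have hpre : e.target ∩ e.symm ⁻¹' (e.source ∩ e ⁻¹' interior K) ⊆ K := fun u hu =>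
    interior_subset (by simpa only [Set.mem_preimage, e.right_inv hu.1] using hu.2.2)
  have hint : IntegrableOn (fun u => √(firstForm (F ∘ e.symm) u).det) K :=
    ((hF.hypPatch he).contDiffOn_sqrt_det.continuousOn.mono hKt).integrableOn_compact hK
  refine ⟨e.source ∩ e ⁻¹' interior K, hopen.mem_nhds ⟨hx, hxK⟩, ?_⟩
  rw [← Measure.restrict_eq_self _ Set.inter_subset_left, hF.areaMeasure_restrict he,
    chartArea_apply F e hopen.measurableSet]
  exact (lintegral_mono_set hpre).trans_lt hint.lintegral_lt_top

theorem IsHypImmersion.integral_eq_integral_chart (hF : IsHypImmersion F) (he : e ∈ atlas Plane M)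
    {f : M → ℝ} (hf : Continuous f) (h0 : ∀ x ∉ e.source, f x = 0) :
    ∫ x, f x ∂areaMeasure F =
      ∫ u in e.target, √(firstForm (F ∘ e.symm) u).det * f (e.symm u) := by
  rw [← setIntegral_eq_integral_of_forall_compl_eq_zero h0, hF.areaMeasure_restrict he, chartArea,
    integral_map (aemeasurable_symm_withDensity e _) hf.measurable.aestronglyMeasurable,
    integral_withDensity_eq_integral_toReal_smul₀ (hF.aemeasurable_ofReal_sqrt_det he) (by simp)]
  simp only [ENNReal.toReal_ofReal (Real.sqrt_nonneg _), smul_eq_mul]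

theorem IsHypImmersion.lintegral_chart_le (hF : IsHypImmersion F) (he : e ∈ atlas Plane M)
    {f : M → ENNReal} (hf : Measurable f) :
    ∫⁻ u in e.target, ENNReal.ofReal √(firstForm (F ∘ e.symm) u).det * f (e.symm u) ≤
      ∫⁻ x, f x ∂areaMeasure F := by
  calc _ = ∫⁻ x, f x ∂chartArea F e := by
        rw [chartArea, lintegral_map' hf.aemeasurable (aemeasurable_symm_withDensity e _),
          lintegral_withDensity_eq_lintegral_mul₀ (hF.aemeasurable_ofReal_sqrt_det he)
            (g := fun u => f (e.symm u)) (hf.comp_aemeasurable (aemeasurable_symm e))]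
        rfl
    _ ≤ _ := by
        rw [← hF.areaMeasure_restrict he]
        exact lintegral_mono' Measure.restrict_le_self le_rfl

end ChartArea

/-! ### The divergence theorem on a closed surface -/

section Global

variable {M : Type*} [TopologicalSpace M] [ChartedSpace Plane M]

/-- The divergence of the vector field `ψ ∇f` on the surface, where `f = ⟨q, F⟩`, computed at `x` in
the preferred chart at `x`. -/
noncomputable def surfaceDiv (F : M → Mink) (q : Mink) (ψ : M → ℝ) (x : M) : ℝ :=
  patchDiv (F ∘ (chartAt Plane x).symm) q (ψ ∘ (chartAt Plane x).symm) (chartAt Plane x x)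

/-- The unit normal of the surface at `x`, oriented by the preferred chart at `x`. -/
noncomputable def surfaceNormal (F : M → Mink) (x : M) : Mink :=
  unitNormal (F ∘ (chartAt Plane x).symm) (chartAt Plane x x)

theorem continuous_of_forall_chart {f : M → ℝ} (g : OpenPartialHomeomorph M Plane → Plane → ℝ)
    (hg : ∀ e ∈ atlas Plane M, ContinuousOn (g e) e.target)
    (hf : ∀ e ∈ atlas Plane M, ∀ x ∈ e.source, f x = g e (e x)) : Continuous f := by
  refine continuous_iff_continuousAt.2 fun x => ?_
  have he := chart_mem_atlas Plane x
  have hc : ContinuousOn (g (chartAt Plane x) ∘ chartAt Plane x) (chartAt Plane x).source :=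
    (hg _ he).comp (chartAt Plane x).continuousOn (chartAt Plane x).mapsTo
  exact (hc.congr (hf _ he)).continuousAt (chart_source_mem_nhds Plane x)

theorem surfaceDiv_of_notMem_tsupport (F : M → Mink) (q : Mink) {ψ : M → ℝ} {x : M}
    (hx : x ∉ tsupport ψ) : surfaceDiv F q ψ x = 0 := by
  have hlim := (chartAt Plane x).tendsto_symm (mem_chart_source Plane x)
  have hloc : ψ ∘ (chartAt Plane x).symm =ᶠ[nhds (chartAt Plane x x)] fun _ => 0 :=
    hlim.eventually (notMem_tsupport_iff_eventuallyEq.1 hx)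
  rw [surfaceDiv, patchDiv_congr _ q hloc]
  simpa using patchDiv_sum _ q (s := (∅ : Finset Empty)) (ψ := fun _ _ => 0) (by simp)

variable [IsManifold (𝓡 2) ∞ M] {F : M → Mink} {e : OpenPartialHomeomorph M Plane}

theorem contDiffOn_comp_symm {ψ : M → ℝ} (hψ : ContMDiff (𝓡 2) 𝓘(ℝ) 1 ψ)
    (he : e ∈ atlas Plane M) : ContDiffOn ℝ 1 (ψ ∘ e.symm) e.target :=
  contMDiffOn_iff_contDiffOn.1 <| hψ.comp_contMDiffOn <|
    (contMDiffOn_symm_of_mem_maximalAtlas (n := ∞) (IsManifold.subset_maximalAtlas he)).of_le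
      (by exact_mod_cast le_top)

theorem differentiableAt_comp_chartAt_symm {ψ : M → ℝ} (hψ : ContMDiff (𝓡 2) 𝓘(ℝ) 1 ψ) (x : M) :
    DifferentiableAt ℝ (ψ ∘ (chartAt Plane x).symm) (chartAt Plane x x) :=
  ((contDiffOn_comp_symm hψ (chart_mem_atlas Plane x)).contDiffAt
    (chart_target_mem_nhds Plane x)).differentiableAt one_ne_zero

theorem reparam_chartAt (F : M → Mink) (he : e ∈ atlas Plane M) {x : M} (hx : x ∈ e.source) :
    Reparam (F ∘ e.symm) (F ∘ (chartAt Plane x).symm) (chartAt Plane x ∘ e.symm) (e x) :=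
  reparam_of_mem_atlas F he (chart_mem_atlas Plane x) (e.map_source hx)
    (by rw [e.left_inv hx]; exact mem_chart_source Plane x)

namespace IsHypImmersion

theorem meanCurvature_sq_eq (hF : IsHypImmersion F) (he : e ∈ atlas Plane M) {x : M}
    (hx : x ∈ e.source) :
    meanCurvature F x ^ 2 = patchMeanCurvature (F ∘ e.symm) (e x) ^ 2 := by
  have hc := hF.hypPatch (chart_mem_atlas Plane x)
  have hcx := mem_chart_target Plane x
  have htrans : (chartAt Plane x ∘ e.symm) (e x) = chartAt Plane x x := by simp [e.left_inv hx]
  rw [← (hF.hypPatch he).lorentz_patchMeanCurvatureVector_self (e.map_source hx),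
    (reparam_chartAt F he hx).patchMeanCurvatureVector_eq (hF.hypPatch he) (e.map_source hx) hc
      (htrans ▸ hcx), htrans, hc.lorentz_patchMeanCurvatureVector_self hcx]
  rfl

theorem surfaceDiv_eq (hF : IsHypImmersion F) (he : e ∈ atlas Plane M) {x : M}
    (hx : x ∈ e.source) (q : Mink) {ψ : M → ℝ} (hψ : ContMDiff (𝓡 2) 𝓘(ℝ) 1 ψ) :
    surfaceDiv F q ψ x = patchDiv (F ∘ e.symm) q (ψ ∘ e.symm) (e x) := by
  have htrans : (chartAt Plane x ∘ e.symm) (e x) = chartAt Plane x x := by simp [e.left_inv hx]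
  have hloc : ψ ∘ e.symm =ᶠ[nhds (e x)]
      (ψ ∘ (chartAt Plane x).symm) ∘ (chartAt Plane x ∘ e.symm) := by
    filter_upwards [(e.tendsto_symm hx).eventually (chart_source_mem_nhds Plane x)] with v hv
    simp only [Function.comp_apply, (chartAt Plane x).left_inv hv]
  rw [patchDiv_congr _ q hloc, (reparam_chartAt F he hx).patchDiv_eq (hF.hypPatch he)
    (e.map_source hx) (hF.hypPatch (chart_mem_atlas Plane x))
    (htrans ▸ mem_chart_target Plane x) (htrans ▸ differentiableAt_comp_chartAt_symm hψ x), htrans]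
  rfl

theorem continuous_meanCurvature_sq (hF : IsHypImmersion F) :
    Continuous fun x => meanCurvature F x ^ 2 :=
  continuous_of_forall_chart
    (fun e u => lorentz (patchMeanCurvatureVector (F ∘ e.symm) u)
      (patchMeanCurvatureVector (F ∘ e.symm) u))
    (fun _ he => (contDiffOn_lorentz (hF.hypPatch he).contDiffOn_patchMeanCurvatureVector
      (hF.hypPatch he).contDiffOn_patchMeanCurvatureVector).continuousOn)
    fun e he x hx => by
      rw [hF.meanCurvature_sq_eq he hx,
        (hF.hypPatch he).lorentz_patchMeanCurvatureVector_self (e.map_source hx)]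

theorem continuous_surfaceDiv (hF : IsHypImmersion F) (q : Mink) {ψ : M → ℝ}
    (hψ : ContMDiff (𝓡 2) 𝓘(ℝ) 1 ψ) : Continuous (surfaceDiv F q ψ) :=
  continuous_of_forall_chart (fun e => patchDiv (F ∘ e.symm) q (ψ ∘ e.symm))
    (fun _ he => (hF.hypPatch he).continuousOn_patchDiv (contDiffOn_comp_symm hψ he) q)
    fun _ he _ hx => hF.surfaceDiv_eq he hx q hψ

theorem surfaceDiv_comp_lorentz (hF : IsHypImmersion F) (q : Mink) {k : ℝ → ℝ} {x : M}
    (hk : DifferentiableAt ℝ k (lorentz q (F x))) :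
    surfaceDiv F q (fun x => k (lorentz q (F x))) x =
      k (lorentz q (F x)) * (2 * lorentz q (F x) +
        2 * meanCurvature F x * lorentz q (surfaceNormal F x)) +
      deriv k (lorentz q (F x)) *
        (lorentz q q + lorentz q (F x) ^ 2 - lorentz q (surfaceNormal F x) ^ 2) := by
  have hx : (F ∘ (chartAt Plane x).symm) (chartAt Plane x x) = F x := by simp
  have hdiv := (hF.hypPatch (chart_mem_atlas Plane x)).patchDiv_comp_lorentz
    (mem_chart_target Plane x) q (k := k) (by rwa [hx])
  rwa [hx] at hdiv

end IsHypImmersion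

theorem surfaceDiv_sum (F : M → Mink) (q : Mink) {ι : Type*} {s : Finset ι} {ψ : ι → M → ℝ}
    (hψ : ∀ j ∈ s, ContMDiff (𝓡 2) 𝓘(ℝ) 1 (ψ j)) (x : M) :
    surfaceDiv F q (fun x => ∑ j ∈ s, ψ j x) x = ∑ j ∈ s, surfaceDiv F q (ψ j) x :=
  patchDiv_sum _ q fun j hj => differentiableAt_comp_chartAt_symm (hψ j hj) x

variable [CompactSpace M]

variable (M) in
theorem exists_finite_partitionOfUnity_subordinate_charts [T2Space M] :
    ∃ (t : Finset M) (ρ : t → M → ℝ), (∀ i, ContMDiff (𝓡 2) 𝓘(ℝ) ∞ (ρ i)) ∧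
      (∀ x, ∑ i, ρ i x = 1) ∧ ∀ i : t, tsupport (ρ i) ⊆ (chartAt Plane (i : M)).source := by
  obtain ⟨t, -, ht⟩ := isCompact_univ.elim_nhds_subcover (fun x : M => (chartAt Plane x).source)
    fun x _ => chart_source_mem_nhds Plane x
  obtain ⟨ρ, hρ⟩ := SmoothPartitionOfUnity.exists_isSubordinate (𝓡 2) (isClosed_univ (X := M))
    (fun i : t => (chartAt Plane (i : M)).source) (fun i => (chartAt Plane (i : M)).open_source)
    (by simpa [Set.iUnion_subtype] using ht)
  refine ⟨t, fun i => ρ i, fun i => (ρ i).contMDiff, fun x => ?_, hρ⟩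
  rw [← finsum_eq_sum_of_fintype]
  exact ρ.sum_eq_one (Set.mem_univ x)

variable [MeasurableSpace M] [BorelSpace M]

namespace IsHypImmersion

theorem integrable_of_continuous (hF : IsHypImmersion F) {f : M → ℝ} (hf : Continuous f) :
    Integrable f (areaMeasure F) := by
  have := hF.isLocallyFiniteMeasure
  exact hf.integrable_of_hasCompactSupport (.of_compactSpace f)

theorem integral_surfaceDiv_of_tsupport_subset (hF : IsHypImmersion F) (he : e ∈ atlas Plane M)
    (q : Mink) {ψ : M → ℝ} (hψ : ContMDiff (𝓡 2) 𝓘(ℝ) 1 ψ) (hsupp : tsupport ψ ⊆ e.source) :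
    ∫ x, surfaceDiv F q ψ x ∂areaMeasure F = 0 := by
  have hK : IsCompact (e '' tsupport ψ) :=
    (isClosed_tsupport ψ).isCompact.image_of_continuousOn (e.continuousOn.mono hsupp)
  have hKU : e '' tsupport ψ ⊆ e.target := Set.image_subset_iff.2 fun x hx => e.mapsTo (hsupp hx)
  have h0 (u) (hu : u ∈ e.target) (huK : u ∉ e '' tsupport ψ) : ψ (e.symm u) = 0 :=
    image_eq_zero_of_notMem_tsupport fun hx => huK ⟨_, hx, e.right_inv hu⟩
  rw [hF.integral_eq_integral_chart he (hF.continuous_surfaceDiv q hψ)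
      fun x hx => surfaceDiv_of_notMem_tsupport F q fun h => hx (hsupp h),
    ← (hF.hypPatch he).integral_patchDiv hK hKU (contDiffOn_comp_symm hψ he) h0 q]
  refine setIntegral_congr_fun e.open_target.measurableSet fun u hu => ?_
  simp only [hF.surfaceDiv_eq he (e.map_target hu) q hψ, e.right_inv hu]

theorem integral_surfaceDiv [T2Space M] (hF : IsHypImmersion F) (q : Mink) {ψ : M → ℝ}
    (hψ : ContMDiff (𝓡 2) 𝓘(ℝ) 1 ψ) : ∫ x, surfaceDiv F q ψ x ∂areaMeasure F = 0 := by
  obtain ⟨t, ρ, hρ, hsum, hsupp⟩ := exists_finite_partitionOfUnity_subordinate_charts M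
  have hρψ (i) : ContMDiff (𝓡 2) 𝓘(ℝ) 1 fun x => ρ i x * ψ x :=
    ((hρ i).of_le (by exact_mod_cast le_top)).mul hψ
  have hψ_eq : ψ = fun x => ∑ i, ρ i x * ψ x := by
    ext x
    rw [← Finset.sum_mul, hsum, one_mul]
  rw [hψ_eq]
  simp only [surfaceDiv_sum F q fun i _ => hρψ i]
  rw [integral_finsetSum _ fun i _ =>
    hF.integrable_of_continuous (hF.continuous_surfaceDiv q (hρψ i))]
  exact Finset.sum_eq_zero fun i _ => hF.integral_surfaceDiv_of_tsupport_subset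
    (chart_mem_atlas Plane (i : M)) q (hρψ i) ((tsupport_mul_subset_left).trans (hsupp i))

end IsHypImmersion

end Global

/-! ### The radial test function -/

section Radial

theorem hasDerivAt_max_zero_sq (z : ℝ) :
    HasDerivAt (fun z : ℝ => max z 0 ^ 2) (2 * max z 0) z := by
  refine hasDerivAt_of_hasDerivAt_of_ne' (f := fun z : ℝ => max z 0 ^ 2) (g := fun z => 2 * max z 0)
    (x := 0) (fun y hy => ?_) (by fun_prop) (by fun_prop) z
  rcases hy.lt_or_gt with h | h
  · have hzero : (fun z : ℝ => max z 0 ^ 2) =ᶠ[nhds y] fun _ => 0 := by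
      filter_upwards [gt_mem_nhds h] with x hx
      simp [max_eq_right hx.le]
    rw [max_eq_right h.le, mul_zero]
    exact (hasDerivAt_const y (0 : ℝ)).congr_of_eventuallyEq hzero
  · have hsq : (fun z : ℝ => max z 0 ^ 2) =ᶠ[nhds y] fun z => z ^ 2 := by
      filter_upwards [lt_mem_nhds h] with x hx
      rw [max_eq_left hx.le]
    rw [max_eq_left h.le]
    simpa using (hasDerivAt_pow 2 y).congr_of_eventuallyEq hsq

theorem contDiff_max_zero_sq : ContDiff ℝ 1 fun z : ℝ => max z 0 ^ 2 := by
  rw [contDiff_one_iff_deriv, funext fun z => (hasDerivAt_max_zero_sq z).deriv]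
  exact ⟨fun z => (hasDerivAt_max_zero_sq z).differentiableAt, by fun_prop⟩

/-- The cutoff `(1 - sinh² r / S)₊` as a function of `t = cosh r`. -/
noncomputable def cutoff (S t : ℝ) : ℝ := max (1 - (t ^ 2 - 1) / S) 0

/-- The radial weight `(1 - sinh² r / S)₊² / (sinh² r + c)` as a function of `t = cosh r`. It
multiplies the gradient of `cosh r` in the divergence theorem. -/
noncomputable def radialWeight (S c t : ℝ) : ℝ := cutoff S t ^ 2 / (t ^ 2 - 1 + c)

/-- The kernel `c (1 - sinh² r / S)₊² / (sinh² r + c)²` as a function of `t = cosh r`. As `c → 0` it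
concentrates at `r = 0`, where it has mass `π` on every surface. -/
noncomputable def regularizedKernel (S c t : ℝ) : ℝ := c * cutoff S t ^ 2 / (t ^ 2 - 1 + c) ^ 2

variable {S c t R : ℝ}

theorem cutoff_nonneg (S t : ℝ) : 0 ≤ cutoff S t := le_max_right _ _

theorem continuous_cutoff (S : ℝ) : Continuous (cutoff S) := by
  unfold cutoff; fun_prop

theorem cutoff_one (S : ℝ) : cutoff S 1 = 1 := by simp [cutoff]

theorem cutoff_le_one (hS : 0 < S) (ht : 1 ≤ t) : cutoff S t ≤ 1 :=
  max_le (sub_le_self _ (div_nonneg (by nlinarith) hS.le)) zero_le_one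

theorem cutoff_eq_zero (hR : 0 < R) (ht : Real.cosh R ≤ t) : cutoff (Real.sinh R ^ 2) t = 0 := by
  refine max_eq_right ?_
  rw [sub_nonpos, one_le_div (pow_pos (Real.sinh_pos_iff.2 hR) 2), Real.sinh_sq]
  gcongr

theorem sq_sub_one_add_pos (hc : 0 < c) (ht : 1 ≤ t) : 0 < t ^ 2 - 1 + c := by nlinarith

theorem contDiffOn_radialWeight (S c : ℝ) :
    ContDiffOn ℝ 1 (radialWeight S c) {t | 0 < t ^ 2 - 1 + c} :=
  (contDiff_max_zero_sq.comp
    (by fun_prop : ContDiff ℝ 1 fun t : ℝ => 1 - (t ^ 2 - 1) / S)).contDiffOn.div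
    (by fun_prop) fun _ ht => ne_of_gt ht

theorem contDiffAt_radialWeight (S : ℝ) (hc : 0 < c) (ht : 1 ≤ t) :
    ContDiffAt ℝ 1 (radialWeight S c) t :=
  (contDiffOn_radialWeight S c).contDiffAt
    ((isOpen_lt continuous_const (by fun_prop)).mem_nhds (sq_sub_one_add_pos hc ht))

theorem continuousOn_regularizedKernel (S : ℝ) (hc : 0 < c) :
    ContinuousOn (regularizedKernel S c) (Set.Ici 1) :=
  (continuousOn_const.mul ((continuous_cutoff S).continuousOn.pow 2)).div (by fun_prop)
    fun _ ht => (pow_pos (sq_sub_one_add_pos hc ht) 2).ne'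

theorem regularizedKernel_nonneg (S t : ℝ) (hc : 0 < c) : 0 ≤ regularizedKernel S c t := by
  unfold regularizedKernel; positivity

theorem deriv_radialWeight (S : ℝ) (ht : t ^ 2 - 1 + c ≠ 0) :
    deriv (radialWeight S c) t = -(4 * t * cutoff S t / (S * (t ^ 2 - 1 + c)) +
      2 * t * cutoff S t ^ 2 / (t ^ 2 - 1 + c) ^ 2) := by
  have hs : HasDerivAt (fun t : ℝ => t ^ 2 - 1) (2 * t) t := by
    simpa using (hasDerivAt_pow 2 t).sub_const 1
  have hcut : HasDerivAt (fun t : ℝ => cutoff S t ^ 2) (2 * cutoff S t * (-(2 * t / S))) t :=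
    HasDerivAt.comp (h₂ := fun z : ℝ => max z 0 ^ 2) t (hasDerivAt_max_zero_sq _)
      ((hs.div_const S).const_sub 1)
  have hweight : HasDerivAt (radialWeight S c) _ t := hcut.div (hs.add_const c) ht
  rw [hweight.deriv]
  rcases eq_or_ne S 0 with rfl | hS
  · simp; field_simp
  · field_simp
    ring

theorem radialWeight_bound (hS : 0 < S) (hc : 0 < c) (ht : 1 ≤ t) (H n : ℝ) :
    2 * (regularizedKernel S c t - 2 / S * (t * cutoff S t)
      - 1 / 4 * (H ^ 2 * cutoff S t ^ 2)) ≤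
    radialWeight S c t * (2 * t + 2 * H * n) +
      deriv (radialWeight S c) t * (-1 + t ^ 2 - n ^ 2) := by
  have hs := sq_sub_one_add_pos hc ht
  have hy := cutoff_nonneg S t
  rw [deriv_radialWeight S hs.ne', radialWeight, regularizedKernel, ← sub_nonneg]
  set y := cutoff S t
  set s := t ^ 2 - 1 + c
  -- The last square absorbs the cross term `2 H n y² / s` coming from the mean curvature.
  have hsquares : y ^ 2 / s * (2 * t + 2 * H * n) +
      -(4 * t * y / (S * s) + 2 * t * y ^ 2 / s ^ 2) * (-1 + t ^ 2 - n ^ 2) -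
      2 * (c * y ^ 2 / s ^ 2 - 2 / S * (t * y) - 1 / 4 * (H ^ 2 * y ^ 2)) =
      2 * (t - 1) * (c + n ^ 2) * (y / s) ^ 2 + 4 * t * y / (S * s) * (c + n ^ 2) +
      2 * (n * (y / s) + H * y / 2) ^ 2 := by
    rw [show -1 + t ^ 2 - n ^ 2 = s - c - n ^ 2 by ring]
    field_simp
    ring
  have : 0 ≤ t - 1 := by linarith
  rw [hsquares]
  positivity

theorem mul_cutoff_le_cosh_sq (hR : 0 < R) (ht : 1 ≤ t) :
    t * cutoff (Real.sinh R ^ 2) t ≤ Real.cosh (R / 2) ^ 2 := by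
  have hS : 0 < Real.sinh R ^ 2 := pow_pos (Real.sinh_pos_iff.2 hR) 2
  have hcosh : 1 + Real.sinh R ^ 2 / 4 ≤ (Real.cosh (R / 2) ^ 2) ^ 2 := by
    have hdouble : Real.sinh R = 2 * Real.sinh (R / 2) * Real.cosh (R / 2) := by
      rw [← Real.sinh_two_mul, mul_div_cancel₀ R two_ne_zero]
    rw [hdouble, mul_pow, Real.cosh_sq]
    nlinarith [sq_nonneg (Real.sinh (R / 2))]
  set S := Real.sinh R ^ 2
  set y := cutoff S t with hy
  refine le_of_sq_le_sq (le_trans ?_ hcosh) (sq_nonneg _)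
  rcases le_total (1 - (t ^ 2 - 1) / S) 0 with hneg | hpos
  · rw [hy, cutoff, max_eq_right hneg]
    nlinarith
  · have hy1 : y ≤ 1 := cutoff_le_one hS ht
    have ht_sq : t ^ 2 = 1 + S * (1 - y) := by
      rw [hy, cutoff, max_eq_left hpos]
      field_simp
      ring
    calc (t * y) ^ 2 = (1 + S * (1 - y)) * y * y := by rw [mul_pow, ht_sq]; ring
      _ ≤ (1 + S * (1 - y)) * y :=
        mul_le_of_le_one_right (mul_nonneg (ht_sq ▸ sq_nonneg t) (cutoff_nonneg S t)) hy1
      _ ≤ 1 + S / 4 := by nlinarith [mul_nonneg hS.le (sq_nonneg (y - 1 / 2))]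

theorem two_div_mul_mul_cutoff_le (hR : 0 < R) (ht : 1 ≤ t) :
    2 / Real.sinh R ^ 2 * (t * cutoff (Real.sinh R ^ 2) t) ≤ 2 / R ^ 2 := by
  have hsinh : R / 2 ≤ Real.sinh (R / 2) := Real.self_le_sinh_iff.2 (by positivity)
  have hS : 0 < Real.sinh R ^ 2 := pow_pos (Real.sinh_pos_iff.2 hR) 2
  have hdouble : Real.sinh R = 2 * Real.sinh (R / 2) * Real.cosh (R / 2) := by
    rw [← Real.sinh_two_mul, mul_div_cancel₀ R two_ne_zero]
  rw [div_mul_eq_mul_div, div_le_div_iff₀ hS (by positivity), mul_assoc]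
  refine mul_le_mul_of_nonneg_left ?_ zero_le_two
  calc t * cutoff (Real.sinh R ^ 2) t * R ^ 2
      ≤ Real.cosh (R / 2) ^ 2 * (2 * Real.sinh (R / 2)) ^ 2 := by
        gcongr
        · exact mul_cutoff_le_cosh_sq hR ht
        · linarith
    _ = Real.sinh R ^ 2 := by rw [hdouble]; ring

end Radial

/-! ### The monotonicity inequality -/

/-- The part of the surface in the ball of `ℍ³` of radius `R` around `F x₀`. -/
def extrinsicBall {M : Type*} (F : M → Mink) (x₀ : M) (R : ℝ) : Set M :=
  {x | hypDist (F x₀) (F x) < R}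

namespace IsHypImmersion

variable {M : Type*} [TopologicalSpace M] [ChartedSpace Plane M] {F : M → Mink}

theorem continuous_hypDist (hF : IsHypImmersion F) :
    Continuous fun p : M × M => hypDist (F p.1) (F p.2) :=
  Real.continuousOn_arcosh.comp_continuous
    (continuous_lorentz.comp ((hF.smooth.continuous.comp continuous_fst).prodMk
      (hF.smooth.continuous.comp continuous_snd))).neg
    fun p => one_le_neg_lorentz (hF.mem p.1) (hF.mem p.2)

theorem isOpen_extrinsicBall (hF : IsHypImmersion F) (x₀ : M) (R : ℝ) :
    IsOpen (extrinsicBall F x₀ R) :=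
  isOpen_lt (hF.continuous_hypDist.comp (.prodMk_right x₀)) continuous_const

theorem continuous_lorentz (hF : IsHypImmersion F) (q : Mink) :
    Continuous fun x => lorentz q (F x) :=
  _root_.continuous_lorentz.comp (continuous_const.prodMk hF.smooth.continuous)

theorem one_le_lorentz_neg (hF : IsHypImmersion F) (x₀ x : M) : 1 ≤ lorentz (-F x₀) (F x) := by
  rw [lorentz_neg_left]
  exact one_le_neg_lorentz (hF.mem x₀) (hF.mem x)

theorem cutoff_of_notMem_extrinsicBall (hF : IsHypImmersion F) {x₀ x : M} {R : ℝ} (hR : 0 < R)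
    (hx : x ∉ extrinsicBall F x₀ R) :
    cutoff (Real.sinh R ^ 2) (lorentz (-F x₀) (F x)) = 0 := by
  refine cutoff_eq_zero hR ?_
  rw [lorentz_neg_left, ← cosh_hypDist (hF.mem x₀) (hF.mem x), Real.cosh_le_cosh, abs_of_pos hR]
  exact (not_lt.1 hx).trans (le_abs_self _)

theorem contMDiff_radialWeight (hF : IsHypImmersion F) (x₀ : M) (S : ℝ) {c : ℝ} (hc : 0 < c) :
    ContMDiff (𝓡 2) 𝓘(ℝ) 1 fun x => radialWeight S c (lorentz (-F x₀) (F x)) := fun x =>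
  (contDiffAt_radialWeight S hc (hF.one_le_lorentz_neg x₀ x)).contMDiffAt.comp x
    (((lorentzCLM (-F x₀)).contMDiff.comp hF.smooth).of_le (by exact_mod_cast le_top) x)

theorem continuous_regularizedKernel (hF : IsHypImmersion F) (x₀ : M) (S : ℝ) {c : ℝ}
    (hc : 0 < c) : Continuous fun x => regularizedKernel S c (lorentz (-F x₀) (F x)) :=
  (continuousOn_regularizedKernel S hc).comp_continuous (hF.continuous_lorentz _)
    (hF.one_le_lorentz_neg x₀)

variable [IsManifold (𝓡 2) ∞ M] (x₀ : M) {R c : ℝ}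

theorem regularizedKernel_le_add_surfaceDiv (hF : IsHypImmersion F) (hR : 0 < R) (hc : 0 < c)
    (x : M) :
    regularizedKernel (Real.sinh R ^ 2) c (lorentz (-F x₀) (F x)) ≤
      (extrinsicBall F x₀ R).indicator (fun x => 2 / R ^ 2 + meanCurvature F x ^ 2 / 4) x +
        surfaceDiv F (-F x₀)
          (fun x => radialWeight (Real.sinh R ^ 2) c (lorentz (-F x₀) (F x))) x / 2 := by
  have hS : 0 < Real.sinh R ^ 2 := pow_pos (Real.sinh_pos_iff.2 hR) 2
  have ht := hF.one_le_lorentz_neg x₀ x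
  have hq : lorentz (-F x₀) (-F x₀) = -1 := by
    rw [lorentz_neg_left, lorentz_comm, lorentz_neg_left, (hF.mem x₀).1, neg_neg]
  have hdiv := radialWeight_bound hS hc ht (meanCurvature F x)
    (lorentz (-F x₀) (surfaceNormal F x))
  rw [← hq, ← hF.surfaceDiv_comp_lorentz (-F x₀)
    ((contDiffAt_radialWeight _ hc ht).differentiableAt one_ne_zero)] at hdiv
  by_cases hx : x ∈ extrinsicBall F x₀ R
  · rw [Set.indicator_of_mem hx]
    have hcut := two_div_mul_mul_cutoff_le hR ht
    have hH : meanCurvature F x ^ 2 * cutoff (Real.sinh R ^ 2) (lorentz (-F x₀) (F x)) ^ 2 ≤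
        meanCurvature F x ^ 2 :=
      mul_le_of_le_one_right (sq_nonneg _)
        (pow_le_one₀ (cutoff_nonneg _ _) (cutoff_le_one hS ht))
    linarith
  · rw [Set.indicator_of_notMem hx]
    rw [hF.cutoff_of_notMem_extrinsicBall hR hx] at hdiv
    linarith

variable [CompactSpace M] [MeasurableSpace M] [BorelSpace M]

theorem integrable_add_meanCurvature_sq (hF : IsHypImmersion F) (a : ℝ) :
    Integrable (fun x => a + meanCurvature F x ^ 2 / 4) (areaMeasure F) :=
  hF.integrable_of_continuous (continuous_const.add (hF.continuous_meanCurvature_sq.div_const 4))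

theorem integral_regularizedKernel_le [T2Space M] (hF : IsHypImmersion F) (hR : 0 < R)
    (hc : 0 < c) :
    ∫ x, regularizedKernel (Real.sinh R ^ 2) c (lorentz (-F x₀) (F x)) ∂areaMeasure F ≤
      ∫ x in extrinsicBall F x₀ R, (2 / R ^ 2 + meanCurvature F x ^ 2 / 4) ∂areaMeasure F := by
  have hball := (hF.isOpen_extrinsicBall x₀ R).measurableSet
  have hweight := hF.contMDiff_radialWeight x₀ (Real.sinh R ^ 2) hc
  have hint := (hF.integrable_add_meanCurvature_sq (2 / R ^ 2)).indicator hball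
  have hdiv := (hF.integrable_of_continuous (hF.continuous_surfaceDiv (-F x₀) hweight)).div_const 2
  calc _ ≤ _ := integral_mono
        (hF.integrable_of_continuous (hF.continuous_regularizedKernel x₀ _ hc)) (hint.add hdiv)
        (hF.regularizedKernel_le_add_surfaceDiv x₀ hR hc)
    _ = _ := by
        rw [integral_add' hint hdiv, integral_div, hF.integral_surfaceDiv _ hweight, zero_div,
          add_zero, integral_indicator hball]

end IsHypImmersion

/-! ### The density at a point -/

section Blowup

open Filter Topology Module

theorem integral_Ioi_mul_inv_one_add_sq_sq :
    ∫ y in Set.Ioi (0 : ℝ), y * ((1 + y ^ 2) ^ 2)⁻¹ = 1 / 2 := by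
  have hderiv (y : ℝ) : HasDerivAt (fun y : ℝ => -(1 / 2) * (1 + y ^ 2)⁻¹)
      (y * ((1 + y ^ 2) ^ 2)⁻¹) y := by
    have hsq : HasDerivAt (fun y : ℝ => 1 + y ^ 2) (2 * y) y := by
      simpa using (hasDerivAt_pow 2 y).const_add 1
    refine ((hsq.fun_inv (by positivity)).const_mul (-(1 / 2))).congr_deriv ?_
    field_simp
  have hlim : Tendsto (fun y : ℝ => -(1 / 2) * (1 + y ^ 2)⁻¹) atTop (𝓝 0) := by
    have hsq : Tendsto (fun y : ℝ => 1 + y ^ 2) atTop atTop :=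
      tendsto_atTop_add_const_left _ _ (tendsto_pow_atTop two_ne_zero)
    simpa using (tendsto_inv_atTop_zero.comp hsq).const_mul (-(1 / 2 : ℝ))
  rw [integral_Ioi_of_hasDerivAt_of_nonneg' (fun y _ => hderiv y)
    (fun y hy => mul_nonneg (le_of_lt hy) (by positivity)) hlim]
  norm_num

theorem lintegral_inv_one_add_norm_sq_sq :
    ∫⁻ v : Plane, ENNReal.ofReal ((1 + ‖v‖ ^ 2) ^ 2)⁻¹ = ENNReal.ofReal Real.pi := by
  have hball : (volume : Measure Plane).real (Metric.ball 0 1) = Real.pi := by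
    simp [Measure.real, Real.pi_nonneg]
  have hpi : ∫ v : Plane, ((1 + ‖v‖ ^ 2) ^ 2)⁻¹ = Real.pi := by
    rw [integral_fun_norm_addHaar volume fun y => ((1 + y ^ 2) ^ 2)⁻¹, hball]
    simp only [finrank_euclideanSpace, Fintype.card_fin, Nat.add_one_sub_one, pow_one, smul_eq_mul,
      integral_Ioi_mul_inv_one_add_sq_sq, nsmul_eq_mul, Nat.cast_ofNat]
    ring
  rw [← hpi, ofReal_integral_eq_lintegral_ofReal
    (.of_integral_ne_zero (hpi ▸ Real.pi_ne_zero)) (.of_forall fun v => by positivity)]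

section Haar

variable {E : Type*} [NormedAddCommGroup E] [NormedSpace ℝ E] [FiniteDimensional ℝ E]
  [MeasurableSpace E] [BorelSpace E] (μ : Measure E) [μ.IsAddHaarMeasure]

theorem lintegral_comp_linearMap {L : E →ₗ[ℝ] E} (hL : L.det ≠ 0) {f : E → ENNReal}
    (hf : Measurable f) :
    ENNReal.ofReal |L.det| * ∫⁻ v, f (L v) ∂μ = ∫⁻ v, f v ∂μ := by
  rw [← lintegral_map hf L.continuous_of_finiteDimensional.measurable,
    Measure.map_linearMap_addHaar_eq_smul_addHaar μ hL, lintegral_smul_measure, smul_eq_mul,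
    ← mul_assoc, ← ENNReal.ofReal_mul (abs_nonneg _), ← abs_mul, mul_inv_cancel₀ hL, abs_one,
    ENNReal.ofReal_one, one_mul]

theorem lintegral_comp_add_smul (u₀ : E) {ε : ℝ} (hε : 0 < ε) {f : E → ENNReal}
    (hf : Measurable f) :
    ENNReal.ofReal (ε ^ finrank ℝ E) * ∫⁻ v, f (u₀ + ε • v) ∂μ = ∫⁻ v, f v ∂μ := by
  have hdet : (ε • LinearMap.id : E →ₗ[ℝ] E).det = ε ^ finrank ℝ E := by simp
  have hscale := lintegral_comp_linearMap μ (L := ε • LinearMap.id) (by rw [hdet]; positivity)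
    (hf.comp (measurable_const_add u₀))
  rw [hdet, abs_of_pos (by positivity)] at hscale
  exact hscale.trans (lintegral_add_left_eq_self f u₀)

theorem lintegral_le_of_tendsto_blowup (u₀ : E) {ρ : ℝ → E → ENNReal} {g : E → ENNReal}
    {K : ENNReal} (hρ : ∀ ε > 0, Measurable (ρ ε))
    (hlim : ∀ v, Tendsto (fun ε => ENNReal.ofReal (ε ^ finrank ℝ E) * ρ ε (u₀ + ε • v)) (𝓝[>] 0)
      (𝓝 (g v)))
    (hK : ∀ ε > 0, ∫⁻ v, ρ ε v ∂μ ≤ K) : ∫⁻ v, g v ∂μ ≤ K := by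
  obtain ⟨ε, -, hpos, hε⟩ := exists_seq_strictAnti_tendsto_nhdsWithin (0 : ℝ)
  calc ∫⁻ v, g v ∂μ
      = ∫⁻ v, liminf (fun n => ENNReal.ofReal (ε n ^ finrank ℝ E) * ρ (ε n) (u₀ + ε n • v)) atTop
          ∂μ := lintegral_congr fun v => ((hlim v).comp hε).liminf_eq.symm
    _ ≤ liminf (fun n => ∫⁻ v, ENNReal.ofReal (ε n ^ finrank ℝ E) * ρ (ε n) (u₀ + ε n • v) ∂μ)
          atTop := lintegral_liminf_le fun n =>
            ((hρ _ (hpos n)).comp ((measurable_const_smul (ε n)).const_add u₀)).const_mul _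
    _ = liminf (fun n => ∫⁻ v, ρ (ε n) v ∂μ) atTop := by
          congr 1 with n
          rw [lintegral_const_mul' _ _ ENNReal.ofReal_ne_top,
            lintegral_comp_add_smul μ u₀ (hpos n) (hρ _ (hpos n))]
    _ ≤ K := (liminf_le_liminf (.of_forall fun n => hK _ (hpos n))).trans_eq (liminf_const K)

end Haar

open scoped MatrixOrder Matrix.Norms.L2Operator in
theorem lintegral_comp_dotProduct_mulVec {n : Type*} [Fintype n] [DecidableEq n]
    {A : Matrix n n ℝ} (hA : A.PosDef) {f : ℝ → ENNReal} (hf : Measurable f) :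
    ENNReal.ofReal √A.det * ∫⁻ v : EuclideanSpace ℝ n, f (v ⬝ᵥ A *ᵥ v) =
      ∫⁻ v : EuclideanSpace ℝ n, f (‖v‖ ^ 2) := by
  obtain ⟨B, rfl⟩ := CStarAlgebra.nonneg_iff_eq_star_mul_self.1 hA.posSemidef.nonneg
  have hdet : (star B * B).det = B.det ^ 2 := by
    rw [Matrix.star_eq_conjTranspose, Matrix.det_mul, Matrix.det_conjTranspose, star_trivial, sq]
  have hB : B.det ≠ 0 := fun h => hA.det_pos.ne' (by rw [hdet, h, sq, zero_mul])
  have hnorm (v : EuclideanSpace ℝ n) :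
      ‖B.toLpLin 2 2 v‖ ^ 2 = v ⬝ᵥ (star B * B) *ᵥ v := by
    rw [EuclideanSpace.real_norm_sq_eq, ← Matrix.mulVec_mulVec, Matrix.dotProduct_mulVec,
      Matrix.star_eq_conjTranspose, Matrix.vecMul_conjTranspose]
    simp [dotProduct, sq]
  have hlin := lintegral_comp_linearMap (volume : Measure (EuclideanSpace ℝ n))
    (L := B.toLpLin 2 2) (by rwa [LinearMap.det_toLpLin]) (f := fun v => f (‖v‖ ^ 2))
    (hf.comp (by fun_prop))
  simpa only [hnorm, LinearMap.det_toLpLin, hdet, Real.sqrt_sq_eq_abs] using hlin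

theorem tendsto_add_smul_nhdsGT {E : Type*} [AddCommGroup E] [Module ℝ E] [TopologicalSpace E]
    [ContinuousAdd E] [ContinuousSMul ℝ E] (u₀ v : E) :
    Tendsto (fun ε : ℝ => u₀ + ε • v) (𝓝[>] 0) (𝓝 u₀) :=
  tendsto_nhdsWithin_of_tendsto_nhds
    (Continuous.tendsto' (by fun_prop) _ _ (by rw [zero_smul, add_zero]))

theorem lorentz_sq_sub_one {x y : Mink} (hx : lorentz x x = -1) (hy : lorentz y y = -1) :
    lorentz x y ^ 2 - 1 = lorentz (y - x) (y - x) * ((1 - lorentz x y) / 2) := by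
  simp only [lorentz_sub_left, lorentz_sub_right, hx, hy, lorentz_comm y x]
  ring

theorem sq_mul_regularizedKernel (S t : ℝ) {ε : ℝ} (hε : ε ≠ 0) :
    ε ^ 2 * regularizedKernel S (ε ^ 2) t =
      cutoff S t ^ 2 * ((1 + (t ^ 2 - 1) / ε ^ 2) ^ 2)⁻¹ := by
  have hfactor : t ^ 2 - 1 + ε ^ 2 = ε ^ 2 * (1 + (t ^ 2 - 1) / ε ^ 2) := by
    field_simp
    ring
  rw [regularizedKernel, hfactor, mul_pow, div_eq_mul_inv, mul_inv]
  field_simp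

namespace HypPatch

variable {φ : Plane → Mink} {U : Set Plane} {u₀ : Plane}

theorem tendsto_lorentz_sq_sub_one_div (h : HypPatch φ U) (hu : u₀ ∈ U) (v : Plane) :
    Tendsto (fun ε : ℝ => (lorentz (φ u₀) (φ (u₀ + ε • v)) ^ 2 - 1) / ε ^ 2) (𝓝[>] 0)
      (𝓝 (v ⬝ᵥ firstForm φ u₀ *ᵥ v)) := by
  have hray := tendsto_add_smul_nhdsGT u₀ v
  have hslope := ((h.differentiableAt hu).hasFDerivAt.hasLineDerivAt v).tendsto_slope_zero_right
  have hmetric := (continuous_lorentz.tendsto _).comp (hslope.prodMk_nhds hslope)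
  have hheight := (continuous_lorentz.tendsto _).comp
    ((tendsto_const_nhds (x := φ u₀)).prodMk_nhds
      ((h.differentiableAt hu).continuousAt.tendsto.comp hray))
  have hlim := hmetric.mul ((hheight.const_sub 1).div_const 2)
  rw [(h.mem u₀ hu).1, lorentz_fderiv_fderiv] at hlim
  norm_num only [mul_one] at hlim
  refine hlim.congr' ?_
  filter_upwards [hray.eventually (h.isOpen.mem_nhds hu)] with ε hεU
  simp only [Function.comp_apply, lorentz_smul_left, lorentz_smul_right,
    lorentz_sq_sub_one (h.mem _ hu).1 (h.mem _ hεU).1]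
  ring

theorem tendsto_sq_mul_regularizedKernel (h : HypPatch φ U) (hu : u₀ ∈ U) (S : ℝ) (v : Plane) :
    Tendsto (fun ε : ℝ => ε ^ 2 * (√(firstForm φ (u₀ + ε • v)).det *
      regularizedKernel S (ε ^ 2) (lorentz (-φ u₀) (φ (u₀ + ε • v))))) (𝓝[>] 0)
      (𝓝 (√(firstForm φ u₀).det * ((1 + v ⬝ᵥ firstForm φ u₀ *ᵥ v) ^ 2)⁻¹)) := by
  have hray := tendsto_add_smul_nhdsGT u₀ v
  have hdet := (h.contDiffOn_sqrt_det.continuousOn.continuousAt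
    (h.isOpen.mem_nhds hu)).tendsto.comp hray
  have hcut : Tendsto (fun ε : ℝ => cutoff S (lorentz (-φ u₀) (φ (u₀ + ε • v)))) (𝓝[>] 0)
      (𝓝 1) := by
    have hheight := ((continuous_cutoff S).tendsto _).comp ((continuous_lorentz.tendsto _).comp
      ((tendsto_const_nhds (x := -φ u₀)).prodMk_nhds
        ((h.differentiableAt hu).continuousAt.tendsto.comp hray)))
    rwa [lorentz_neg_left, (h.mem u₀ hu).1, neg_neg, cutoff_one] at hheight
  have hQ : 0 ≤ v ⬝ᵥ firstForm φ u₀ *ᵥ v := by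
    simpa using (h.posDef_firstForm hu).posSemidef.dotProduct_mulVec_nonneg v
  have hlim := hdet.mul ((hcut.pow 2).mul
    ((((h.tendsto_lorentz_sq_sub_one_div hu v).const_add 1).pow 2).inv₀ (by positivity)))
  rw [one_pow, one_mul] at hlim
  refine hlim.congr' ?_
  filter_upwards [self_mem_nhdsWithin] with ε hε
  rw [mul_left_comm (ε ^ 2), sq_mul_regularizedKernel S _ (ne_of_gt hε), lorentz_neg_left, neg_sq]
  rfl

theorem measurable_indicator_regularizedKernel (h : HypPatch φ U) (hu : u₀ ∈ U) (S : ℝ) {c : ℝ}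
    (hc : 0 < c) : Measurable (U.indicator fun u => ENNReal.ofReal
      (√(firstForm φ u).det * regularizedKernel S c (lorentz (-φ u₀) (φ u)))) := by
  classical
  rw [← Set.piecewise_eq_indicator]
  refine ContinuousOn.measurable_piecewise (ENNReal.continuous_ofReal.comp_continuousOn ?_)
    continuousOn_const h.isOpen.measurableSet
  refine h.contDiffOn_sqrt_det.continuousOn.mul ((continuousOn_regularizedKernel S hc).comp
    (continuous_lorentz.comp_continuousOn
      (continuousOn_const.prodMk h.contDiffOn.continuousOn)) fun u huU => ?_)
  rw [Set.mem_Ici, lorentz_neg_left]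
  exact one_le_neg_lorentz (h.mem u₀ hu) (h.mem u huU)

theorem pi_le_of_forall_lintegral_le (h : HypPatch φ U) (hu : u₀ ∈ U) (S : ℝ) {K : ENNReal}
    (hK : ∀ c > 0, ∫⁻ u in U, ENNReal.ofReal
      (√(firstForm φ u).det * regularizedKernel S c (lorentz (-φ u₀) (φ u))) ≤ K) :
    ENNReal.ofReal Real.pi ≤ K := by
  rw [← lintegral_inv_one_add_norm_sq_sq, ← lintegral_comp_dotProduct_mulVec
    (h.posDef_firstForm hu) (f := fun s => ENNReal.ofReal ((1 + s) ^ 2)⁻¹) (by fun_prop),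
    ← lintegral_const_mul' _ _ ENNReal.ofReal_ne_top]
  refine lintegral_le_of_tendsto_blowup volume u₀
    (fun ε hε => h.measurable_indicator_regularizedKernel hu S (pow_pos hε 2)) (fun v => ?_)
    fun ε hε => (lintegral_indicator h.isOpen.measurableSet _).trans_le (hK _ (pow_pos hε 2))
  rw [← ENNReal.ofReal_mul (Real.sqrt_nonneg _)]
  refine (ENNReal.tendsto_ofReal (h.tendsto_sq_mul_regularizedKernel hu S v)).congr' ?_
  filter_upwards [(tendsto_add_smul_nhdsGT u₀ v).eventually (h.isOpen.mem_nhds hu)] with ε hεU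
  rw [Set.indicator_of_mem hεU, ENNReal.ofReal_mul (sq_nonneg ε), finrank_euclideanSpace,
    Fintype.card_fin]

end HypPatch

end Blowup

theorem IsHypImmersion.pi_le_integral_extrinsicBall {M : Type*} [TopologicalSpace M] [T2Space M]
    [CompactSpace M] [ChartedSpace Plane M] [IsManifold (𝓡 2) ∞ M] [MeasurableSpace M]
    [BorelSpace M] {F : M → Mink} (hF : IsHypImmersion F) (x₀ : M) {R : ℝ} (hR : 0 < R) :
    Real.pi ≤
      ∫ x in extrinsicBall F x₀ R, (2 / R ^ 2 + meanCurvature F x ^ 2 / 4) ∂areaMeasure F := by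
  have he := chart_mem_atlas Plane x₀
  have hx₀ := mem_chart_source Plane x₀
  rw [← ENNReal.ofReal_le_ofReal_iff (integral_nonneg fun x => by positivity)]
  refine (hF.hypPatch he).pi_le_of_forall_lintegral_le ((chartAt Plane x₀).map_source hx₀)
    (Real.sinh R ^ 2) fun c hc => ?_
  rw [Function.comp_apply, (chartAt Plane x₀).left_inv hx₀]
  set f : M → ℝ := fun x => regularizedKernel (Real.sinh R ^ 2) c (lorentz (-F x₀) (F x))
  have hf : Continuous f := hF.continuous_regularizedKernel x₀ _ hc
  calc ∫⁻ u in (chartAt Plane x₀).target, ENNReal.ofReal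
        (√(firstForm (F ∘ (chartAt Plane x₀).symm) u).det * f ((chartAt Plane x₀).symm u))
      = ∫⁻ u in (chartAt Plane x₀).target, ENNReal.ofReal
        √(firstForm (F ∘ (chartAt Plane x₀).symm) u).det *
          ENNReal.ofReal (f ((chartAt Plane x₀).symm u)) :=
        lintegral_congr fun u => ENNReal.ofReal_mul (Real.sqrt_nonneg _)
    _ ≤ ∫⁻ x, ENNReal.ofReal (f x) ∂areaMeasure F :=
        hF.lintegral_chart_le he hf.measurable.ennreal_ofReal
    _ = ENNReal.ofReal (∫ x, f x ∂areaMeasure F) :=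
        (ofReal_integral_eq_lintegral_ofReal (hF.integrable_of_continuous hf)
          (.of_forall fun x => regularizedKernel_nonneg _ _ hc)).symm
    _ ≤ _ := ENNReal.ofReal_le_ofReal (hF.integral_regularizedKernel_le x₀ hR hc)

/-! ### The diameter bound -/

theorem sq_mul_sq_le_of_forall_le {D A W : ℝ} (hD : 0 ≤ D) (hA : 0 ≤ A) (hW : 0 ≤ W)
    (h : ∀ R > 0, D / (2 * R) * Real.pi ≤ 2 / R ^ 2 * A + W / 4) :
    Real.pi ^ 2 * D ^ 2 ≤ 8 * (A * W) := by
  have hquad (R : ℝ) : 0 ≤ W * (R * R) + -(2 * Real.pi * D) * R + 8 * A := by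
    rcases le_or_gt R 0 with hR | hR
    · have := mul_nonneg (mul_nonneg Real.two_pi_pos.le hD) (neg_nonneg.2 hR)
      have := mul_nonneg hW (mul_self_nonneg R)
      linarith
    · have hscaled := mul_le_mul_of_nonneg_left (h R hR) (by positivity : 0 ≤ 4 * R ^ 2)
      field_simp at hscaled
      linarith
  have hdiscrim := discrim_le_zero hquad
  rw [discrim] at hdiscrim
  linarith

section Diameter

variable {M : Type*} {F : M → Mink}

theorem disjoint_extrinsicBall (hF : ∀ x, F x ∈ hyperbolicSpace) {R : ℝ} {x₀ x₁ : M}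
    (hdist : 2 * R ≤ hypDist (F x₀) (F x₁)) :
    Disjoint (extrinsicBall F x₀ R) (extrinsicBall F x₁ R) := by
  refine Set.disjoint_left.2 fun y (hy₀ : _ < R) (hy₁ : _ < R) => ?_
  rw [hypDist_comm] at hy₁
  linarith [hypDist_triangle (hF x₀) (hF y) (hF x₁)]

namespace IsHypImmersion

variable [TopologicalSpace M] [ChartedSpace Plane M]

theorem exists_hypDist_eq [PreconnectedSpace M] (hF : IsHypImmersion F) {p q : M} {r : ℝ}
    (hr : r ∈ Set.Icc 0 (hypDist (F p) (F q))) : ∃ x, hypDist (F p) (F x) = r := by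
  rw [← hypDist_self (hF.mem p)] at hr
  exact intermediate_value_univ p q (hF.continuous_hypDist.comp (.prodMk_right p)) hr

theorem exists_pairwise_disjoint_extrinsicBall [PreconnectedSpace M] (hF : IsHypImmersion F)
    {p q : M} {R : ℝ} (hR : 0 < R) {n : ℕ} (hn : n * (2 * R) ≤ hypDist (F p) (F q)) :
    ∃ x : Fin (n + 1) → M, Pairwise (Function.onFun Disjoint fun i => extrinsicBall F (x i) R) := by
  have hcentre (i : Fin (n + 1)) : ∃ x, hypDist (F p) (F x) = i * (2 * R) := by
    refine hF.exists_hypDist_eq ⟨by positivity, le_trans ?_ hn⟩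
    gcongr
    exact Fin.is_le i
  choose x hx using hcentre
  refine ⟨x, (pairwise_disjoint_on _).2 fun i j hij => disjoint_extrinsicBall hF.mem ?_⟩
  have htriangle := hypDist_triangle (hF.mem p) (hF.mem (x i)) (hF.mem (x j))
  have hgap : ((i : ℕ) + 1 : ℝ) * (2 * R) ≤ (j : ℕ) * (2 * R) := by
    gcongr
    exact_mod_cast hij
  rw [hx, hx] at htriangle
  linarith

variable [CompactSpace M]

theorem isGreatest_extrinsicDiam [Nonempty M] (hF : IsHypImmersion F) :
    IsGreatest (extrinsicDistances F) (extrinsicDiam F) :=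
  (isCompact_range hF.continuous_hypDist).isGreatest_sSup (Set.range_nonempty _)

variable [ConnectedSpace M] [T2Space M] [IsManifold (𝓡 2) ∞ M] [MeasurableSpace M] [BorelSpace M]

theorem extrinsicDiam_div_mul_pi_le (hF : IsHypImmersion F) {R : ℝ} (hR : 0 < R) :
    extrinsicDiam F / (2 * R) * Real.pi ≤
      2 / R ^ 2 * surfaceArea F + willmoreEnergy F / 4 := by
  have hloc := hF.isLocallyFiniteMeasure
  have hint := hF.integrable_add_meanCurvature_sq (2 / R ^ 2)
  have hnonneg (x : M) : 0 ≤ 2 / R ^ 2 + meanCurvature F x ^ 2 / 4 := by positivity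
  obtain ⟨⟨⟨p, q⟩, hpq : hypDist (F p) (F q) = extrinsicDiam F⟩, -⟩ := hF.isGreatest_extrinsicDiam
  have hD : 0 ≤ extrinsicDiam F := hpq ▸ hypDist_nonneg (hF.mem p) (hF.mem q)
  set n := ⌊extrinsicDiam F / (2 * R)⌋₊
  have hn : n * (2 * R) ≤ hypDist (F p) (F q) := by
    rw [hpq, ← le_div_iff₀ (by positivity)]
    exact Nat.floor_le (by positivity)
  obtain ⟨x, hx⟩ := hF.exists_pairwise_disjoint_extrinsicBall hR hn
  calc extrinsicDiam F / (2 * R) * Real.pi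
      ≤ ∑ _i : Fin (n + 1), Real.pi := by
        rw [Finset.sum_const, Finset.card_univ, Fintype.card_fin, nsmul_eq_mul, Nat.cast_add_one]
        gcongr
        exact (Nat.lt_floor_add_one _).le
    _ ≤ ∑ i, ∫ y in extrinsicBall F (x i) R, (2 / R ^ 2 + meanCurvature F y ^ 2 / 4)
          ∂areaMeasure F :=
        Finset.sum_le_sum fun i _ => hF.pi_le_integral_extrinsicBall (x i) hR
    _ = ∫ y in ⋃ i, extrinsicBall F (x i) R, (2 / R ^ 2 + meanCurvature F y ^ 2 / 4)
          ∂areaMeasure F :=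
        (integral_iUnion_fintype (fun i => (hF.isOpen_extrinsicBall (x i) R).measurableSet) hx
          fun i => hint.integrableOn).symm
    _ ≤ ∫ y, (2 / R ^ 2 + meanCurvature F y ^ 2 / 4) ∂areaMeasure F :=
        setIntegral_le_integral hint (.of_forall hnonneg)
    _ = 2 / R ^ 2 * surfaceArea F + willmoreEnergy F / 4 := by
        rw [integral_add (integrable_const _)
          ((hF.integrable_of_continuous hF.continuous_meanCurvature_sq).div_const 4),
          integral_const, integral_div, smul_eq_mul, mul_comm]
        rfl

theorem pi_sq_mul_extrinsicDiam_sq_le (hF : IsHypImmersion F) :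
    Real.pi ^ 2 * extrinsicDiam F ^ 2 ≤ 8 * (surfaceArea F * willmoreEnergy F) := by
  obtain ⟨⟨⟨p, q⟩, hpq : hypDist (F p) (F q) = extrinsicDiam F⟩, -⟩ := hF.isGreatest_extrinsicDiam
  exact sq_mul_sq_le_of_forall_le (hpq ▸ hypDist_nonneg (hF.mem p) (hF.mem q)) measureReal_nonneg
    (integral_nonneg fun x => sq_nonneg _) fun R hR => hF.extrinsicDiam_div_mul_pi_le hR

end IsHypImmersion

end Diameter

/-- Every closed connected surface smoothly immersed in `ℍ³` satisfies
`diam M ≤ 7 / (2π) * A(M)^{1/2} * W(M)^{1/2}`. The first three conjuncts say that the diameter is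
an attained maximum, that the area is finite and that `H²` is integrable. -/
theorem lemma6p3 {M : Type*} [TopologicalSpace M] [T2Space M] [CompactSpace M] [ConnectedSpace M]
    [ChartedSpace Plane M] [IsManifold (𝓡 2) ∞ M] [MeasurableSpace M] [BorelSpace M]
    (F : M → Mink) (hF : IsHypImmersion F) :
    IsGreatest (extrinsicDistances F) (extrinsicDiam F) ∧
    areaMeasure F Set.univ ≠ ⊤ ∧
    Integrable (fun x => meanCurvature F x ^ 2) (areaMeasure F) ∧
    extrinsicDiam F ≤
      7 / (2 * Real.pi) * surfaceArea F ^ (1 / 2 : ℝ) * willmoreEnergy F ^ (1 / 2 : ℝ) := by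
  have hloc := hF.isLocallyFiniteMeasure
  refine ⟨hF.isGreatest_extrinsicDiam, isCompact_univ.measure_lt_top.ne,
    hF.integrable_of_continuous hF.continuous_meanCurvature_sq, ?_⟩
  have hA : 0 ≤ surfaceArea F := measureReal_nonneg
  have hW : 0 ≤ willmoreEnergy F := integral_nonneg fun x => sq_nonneg _
  rw [← Real.sqrt_eq_rpow, ← Real.sqrt_eq_rpow, mul_assoc, ← Real.sqrt_mul hA]
  refine le_of_sq_le_sq ?_ (by positivity)
  rw [mul_pow, div_pow, Real.sq_sqrt (mul_nonneg hA hW), div_mul_eq_mul_div,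
    le_div_iff₀ (by positivity)]
  -- The proof gives the constant `2√2 ≤ 7 / 2`.
  linarith [hF.pi_sq_mul_extrinsicDiam_sq_le, mul_nonneg hA hW]
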